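/- **Model.** A financial network has a finite set $B$ of banks, external assets $e_v\ge 0$, simple debts of weight $\delta_{u,v}\ge 0$ from $u$ to $v$, and credit default swaps (CDSs) of weight $\delta_{u,v}^w\ge 0$ from $u$ to $v$ in reference to $w$; no bank has a contract with itself or in reference to itself. For recovery rates $r\in[0,1]^B$ let $l_{u,v}=\delta_{u,v}+\sum_w\delta_{u,v}^w(1-r_w)$, $l_u=\sum_v l_{u,v}$, $a_v=e_v+\sum_u r_u\,l_{u,v}$, and $R(a,l)=1$ if $a\ge l$, $R(a,l)=a/l$ otherwise. In the reversible sequential model all rates are $1$ initially, and in each step one bank $v$ with $r_v\ne R(a_v,l_v)$ (an *updatable* bank) announces $r_v:=R(a_v,l_v)$; the process stabilizes when no bank is updatable. A *run* is a maximal sequence of such steps, in an arbitrary ordering. Bank $v$ *reports a default* in a step in which $r_v$ changes from $1$ to a value less than $1$. **Gadgets.** A *stable bit* is a pair of banks $v_1,v_2$ with $e_{v_1}=e_{v_2}=0$ and without simple debts (outgoing or incoming), each of which has an outgoing CDS of positive weight in reference to the other, and neither of which receives a CDS in reference to the other. It has value $1$ if $r_{v_1}=r_{v_2}=0$, and value $0$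 if $r_{v_1}=r_{v_2}=1$. A *condition gadget* is a pair of banks $u,w$ with $e_u=e_w=0$ such that, for some integer $c\ge1$, bank $u$ has outgoing debt of total weight $c$ and no incoming debt; for every bank $z$, the CDSs into $u$ in reference to $z$ have total weight $0$ or $1$, and so do the CDSs out of $u$ in reference to $z$; the outgoing contracts of $w$ have total weight $1$; and the incoming contracts of $w$ are CDSs in reference to $u$, of total weight $c+1$. A *state gadget* consists of a condition gadget $u,w$ and a stable bit $v_1,v_2$ where $v_1$ has an outgoing CDS of positive weight in reference to $w$; the state is *active* if the stable bit has value $1$, and *inactive* if it has value $0$. **Machines.** A deterministic Turing machine $M$ with finite state set $Q$, tape alphabet $\Gamma$ and start state $q_0\in Q$ has a partial transition function $Q\times\Gamma\rightharpoonup Q\times\Gamma\times\{\text{left},\text{stay},\text{right}\}$ and halts where it is undefined. On a tape with $m$ cells, the head stays where it is when it is asked to leave the tape (a linear bounded automaton). On input $x\in\Gamma^m$ it starts in $q_0$ with tape content $x$ and with the head on the first cell; $c_0,c_1,\dots$ denotes its (finite or infinite) sequence of configurations. **Theorem.** For every $k\ge 0$ there is a constant $C$ such that the following holds for every finite $Q$,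 every alphabet $\Gamma$ with an injective encoding $\mathrm{enc}:\Gamma\to\{0,1\}^k$, every such machine $M$ and every $m\ge 1$. There are a finite set $B$ with $|B|\le C\,(|Q|+\lceil\log_2 m\rceil+m)$, contracts on $B$ and base external assets $e$ (all independent of the input), with pairwise distinct distinguished banks forming: $k$ stable bits for each of the $m$ tape cells; $\lceil\log_2 m\rceil$ stable bits for the head address; a state gadget for each $q\in Q$; an input bank for each pair $(i,a)$ of a cell $i$ and a symbol $a\in\Gamma$; and a clock bank. For every $x\in\Gamma^m$, let the external assets be $e$ plus one unit at the input banks $(i,x_i)$, $i=1,\dots,m$. Say that $r$ *represents* a configuration if the stable bits of each cell have the values of the encoding of its symbol, those of the address have the values of the binary representation of the head position (counted from $0$), the state gadget of the current state is active, and all other state gadgets are inactive. Then, for every $x\in\Gamma^m$ and every run (i.e. for every ordering of the updates): 1. whenever the clock bank reports a default for the $(t+1)$-st time ($t\ge 0$), the configuration $c_t$ exists and the recovery rates directly after this update represent $c_t$; 2. for every $t$ for which $c_t$ exists, the clock bank does report a default for the $(t+1)$-st time; 3. the process stabilizes if and only if $M$ halts on $x$, and in that case the final recovery rates represent the final configuration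 of $M$. -/

import Mathlib

open scoped NNReal

namespace FinNet

/-! ### Financial networks -/

/-- The contracts between the banks of a set `B`: `debt u v` is the weight of the simple debt from
`u` to `v`, and `cds u v w` is the weight of the credit default swap from `u` to `v` in reference
to `w` (weight `0` means that there is no such contract). No bank enters into a contract with
itself or in reference to itself. -/
structure Contracts (B : Type*) where
  debt : B → B → ℝ≥0
  cds : B → B → B → ℝ≥0
  debt_self : ∀ u, debt u u = 0
  cds_self : ∀ u w, cds u u w = 0
  cds_ref_debtor : ∀ u v, cds u v u = 0
  cds_ref_creditor : ∀ u v, cds u v v = 0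

section Network

variable {B : Type*} [Fintype B] (N : Contracts B) (e : B → ℝ≥0)

/-- The liability of `u` towards `v` under the recovery rates `r`. -/
noncomputable def liabilityTo (r : B → ℝ) (u v : B) : ℝ :=
  N.debt u v + ∑ w, (N.cds u v w : ℝ) * (1 - r w)

/-- The total liability of `u`. -/
noncomputable def liability (r : B → ℝ) (u : B) : ℝ :=
  ∑ v, liabilityTo N r u v

/-- The payment from `u` to `v` (principle of proportionality). -/
noncomputable def payment (r : B → ℝ) (u v : B) : ℝ :=
  r u * liabilityTo N r u v

/-- The assets of `v`: its external assets and its incoming payments. -/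
noncomputable def assets (r : B → ℝ) (v : B) : ℝ :=
  e v + ∑ u, payment N r u v

/-- The recovery rate of a bank with assets `a` and liabilities `l`. -/
noncomputable def recovery (a l : ℝ) : ℝ :=
  if l ≤ a then 1 else a / l

/-- A bank is updatable if its announced recovery rate is not the one that its current assets and
liabilities imply. -/
def Updatable (r : B → ℝ) (v : B) : Prop :=
  r v ≠ recovery (assets N e r v) (liability N r v)

/-- One step of the reversible sequential model: a single updatable bank announces its new
recovery rate (which may be lower or higher than before). -/
def UpdateStep (r r' : B → ℝ) : Prop :=
  ∃ v, Updatable N e r v ∧ r' v = recovery (assets N e r v) (liability N r v) ∧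
    ∀ u, u ≠ v → r' u = r u

/-- No bank is updatable. -/
def Stabilized (r : B → ℝ) : Prop :=
  ∀ v, ¬ Updatable N e r v

/-- `r` is a maximal run of the sequential process, for an arbitrary ordering of the updates: all
recovery rates are `1` in the beginning, and an update is executed in every step, as long as there
is an updatable bank. (From the round in which the process stabilizes, if there is one, the
sequence `r` is constant.) -/
def IsRun (r : ℕ → B → ℝ) : Prop :=
  (∀ v, r 0 v = 1) ∧
    ∀ n, UpdateStep N e (r n) (r (n + 1)) ∨ (Stabilized N e (r n) ∧ r (n + 1) = r n)

end Network

section Defaulting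

variable {B : Type*}

/-- In the step from round `n` to round `n + 1`, bank `v` reports a default. -/
def DefaultingStep (r : ℕ → B → ℝ) (v : B) (n : ℕ) : Prop :=
  r n v = 1 ∧ r (n + 1) v < 1

open Classical in
/-- The number of times that `v` reports a default in the first `n` steps. -/
noncomputable def defaultCount (r : ℕ → B → ℝ) (v : B) (n : ℕ) : ℕ :=
  ((Finset.range n).filter (DefaultingStep r v)).card

end Defaulting

/-! ### Gadgets -/

section Gadgets

variable {B : Type*} [Fintype B] (N : Contracts B) (e : B → ℝ≥0)

/-- A (settable and resettable) stable bit gadget on the banks `v₁`, `v₂`: two banks without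
external assets, which have an outgoing CDS in reference to each other. All their contracts are
conditional, and they receive no payment for the default of their partner; thus they keep the
rates `(0, 0)` and the rates `(1, 1)` until the default of some other bank changes them. -/
structure IsStableBit (v₁ v₂ : B) : Prop where
  ext₁ : e v₁ = 0
  ext₂ : e v₂ = 0
  cds₁ : ∃ x, 0 < N.cds v₁ x v₂
  cds₂ : ∃ x, 0 < N.cds v₂ x v₁
  noDebt₁ : ∀ x, N.debt v₁ x = 0 ∧ N.debt x v₁ = 0
  noDebt₂ : ∀ x, N.debt v₂ x = 0 ∧ N.debt x v₂ = 0
  noPay₁ : ∀ x, N.cds x v₁ v₂ = 0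
  noPay₂ : ∀ x, N.cds x v₂ v₁ = 0

/-- A condition gadget on the banks `u`, `w`. Bank `u` has a debt of weight `c ≥ 1`, incoming CDSs
of weight `1` in reference to the banks that have to be in default, and outgoing CDSs of weight `1`
in reference to the banks that must not be in default. Bank `w` has a single unit of outgoing
contracts (a debt, or a CDS in reference to a bank that signals the end of the initialization), and
its incoming contracts are CDSs in reference to `u`, of total weight `c + 1`. -/
structure IsConditionGadget (u w : B) : Prop where
  extU : e u = 0
  extW : e w = 0
  weights : ∃ c : ℕ, 0 < c ∧ ∑ x, N.debt u x = c ∧ ∑ x, N.cds x w u = c + 1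
  inU : ∀ x, N.debt x u = 0
  posCond : ∀ z, ∑ x, N.cds x u z = 0 ∨ ∑ x, N.cds x u z = 1
  negCond : ∀ z, ∑ x, N.cds u x z = 0 ∨ ∑ x, N.cds u x z = 1
  outW : ∑ x, (N.debt w x + ∑ y, N.cds w x y) = 1
  inW : ∀ x, N.debt x w = 0 ∧ ∀ y, y ≠ u → N.cds x w y = 0

/-- A state gadget: a condition gadget on `u`, `w` and a stable bit gadget on `v₁`, `v₂`, which is
sent into default by the default of `w`. -/
structure IsStateGadget (u w v₁ v₂ : B) : Prop where
  cond : IsConditionGadget N e u w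
  bit : IsStableBit N e v₁ v₂
  trigger : ∃ x, 0 < N.cds v₁ x w

end Gadgets

/-! ### Turing machines with a finite tape -/

/-- The possible moves of the head. -/
inductive Move
  | left
  | stay
  | right

/-- A deterministic Turing machine with state set `Q` and tape alphabet `Γ`. The machine halts in
state `q` on the symbol `a` if `trans q a = none`; if `trans q a = some (q', b, d)`, then it
writes `b`, moves the head according to `d`, and continues in state `q'`. -/
structure Machine (Q Γ : Type*) where
  start : Q
  trans : Q → Γ → Option (Q × Γ × Move)

/-- A configuration of a machine on a tape with `m` cells. -/
structure Config (Q Γ : Type*) (m : ℕ) where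
  state : Q
  tape : Fin m → Γ
  head : Fin m

/-- The head stays where it is if it is asked to leave the tape. -/
def moveHead {m : ℕ} : Move → Fin m → Fin m
  | .left, i => ⟨i - 1, by omega⟩
  | .stay, i => i
  | .right, i => if h : (i : ℕ) + 1 < m then ⟨i + 1, h⟩ else i

/-- One step of a machine; `none` if it halts in the configuration `c`. -/
def Machine.step {Q Γ : Type*} {m : ℕ} (M : Machine Q Γ) (c : Config Q Γ m) :
    Option (Config Q Γ m) :=
  (M.trans c.state (c.tape c.head)).map fun t =>
    { state := t.1
      tape := Function.update c.tape c.head t.2.1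
      head := moveHead t.2.2 c.head }

/-- The initial configuration on the tape content `x`: the start state, with the head on the
first cell. -/
def Machine.init {Q Γ : Type*} {m : ℕ} (M : Machine Q Γ) (hm : 0 < m) (x : Fin m → Γ) :
    Config Q Γ m :=
  { state := M.start
    tape := x
    head := ⟨0, hm⟩ }

/-- The configuration after `t` steps on the tape content `x`; `none` if the machine halts
earlier. -/
def Machine.configAt {Q Γ : Type*} {m : ℕ} (M : Machine Q Γ) (hm : 0 < m) (x : Fin m → Γ) :
    ℕ → Option (Config Q Γ m)
  | 0 => some (M.init hm x)
  | t + 1 => (M.configAt hm x t).bind M.step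

/-! ### Simulation -/

/-- The roles of the distinguished banks of a network that simulates a machine with states `Q`
and alphabet `Γ` (with symbols written as `k` bits) on `m` cells: the input banks, the stable bits
of each cell, the stable bits of the head address (a binary number with `⌈log₂ m⌉` bits), the state
gadgets of the control, and a bank whose defaults mark the rounds at which the configuration is
read off. -/
inductive Port (Q Γ : Type*) (m k : ℕ)
  | input (i : Fin m) (a : Γ)
  | cell₁ (i : Fin m) (j : Fin k)
  | cell₂ (i : Fin m) (j : Fin k)
  | addr₁ (l : Fin (Nat.clog 2 m))
  | addr₂ (l : Fin (Nat.clog 2 m))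
  | ctrlU (q : Q)
  | ctrlW (q : Q)
  | ctrl₁ (q : Q)
  | ctrl₂ (q : Q)
  | clock

section Simulation

variable {Q Γ B : Type*} {m k : ℕ}

/-- The tape cells and the head address are stored in stable bit gadgets, and the states of the
control are state gadgets. -/
structure UsesGadgets [Fintype B] (N : Contracts B) (e : B → ℝ≥0) (port : Port Q Γ m k → B) :
    Prop where
  cell : ∀ i j, IsStableBit N e (port (.cell₁ i j)) (port (.cell₂ i j))
  addr : ∀ l, IsStableBit N e (port (.addr₁ l)) (port (.addr₂ l))
  ctrl : ∀ q, IsStateGadget N e (port (.ctrlU q)) (port (.ctrlW q))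
    (port (.ctrl₁ q)) (port (.ctrl₂ q))

open Classical in
/-- The external assets on the tape content `x`: on top of the fixed assets `e`, for each cell `i`,
one unit is given to the input bank of `i` that belongs to the symbol `x i`. -/
noncomputable def withInput (e : B → ℝ≥0) (port : Port Q Γ m k → B) (x : Fin m → Γ) : B → ℝ≥0 :=
  fun b => e b + if ∃ i, port (.input i (x i)) = b then 1 else 0

/-- The pair `v₁`, `v₂` stores the truth value of `p`: both banks have recovery rate `0` if `p`
holds, and recovery rate `1` otherwise. -/
def StoresBit (r : B → ℝ) (v₁ v₂ : B) (p : Prop) : Prop :=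
  (p → r v₁ = 0 ∧ r v₂ = 0) ∧ (¬ p → r v₁ = 1 ∧ r v₂ = 1)

/-- The recovery rates `r` represent the configuration `c`. -/
structure Represents (enc : Γ → Fin k → Bool) (port : Port Q Γ m k → B) (r : B → ℝ)
    (c : Config Q Γ m) : Prop where
  tape : ∀ i j, StoresBit r (port (.cell₁ i j)) (port (.cell₂ i j)) (enc (c.tape i) j = true)
  head : ∀ l, StoresBit r (port (.addr₁ l)) (port (.addr₂ l)) ((c.head : ℕ).testBit l = true)
  state : ∀ q, StoresBit r (port (.ctrl₁ q)) (port (.ctrl₂ q)) (q = c.state)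

/-- The run `r` of a network simulates the computation of `M` on the tape content `x`. -/
structure SimulatesRun [Fintype B] (N : Contracts B) (e : B → ℝ≥0) (enc : Γ → Fin k → Bool)
    (port : Port Q Γ m k → B) (M : Machine Q Γ) (hm : 0 < m) (x : Fin m → Γ)
    (r : ℕ → B → ℝ) : Prop where
  /-- When the clock bank reports a default, after `t` earlier ones, then the computation has a
  `t`-th configuration, and the network represents it. -/
  sound : ∀ n, DefaultingStep r (port .clock) n →
    ∃ c, M.configAt hm x (defaultCount r (port .clock) n) = some c ∧
      Represents enc port (r (n + 1)) c
  /-- Every configuration of the computation is reached. -/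
  complete : ∀ t, (∃ c, M.configAt hm x t = some c) →
    ∃ n, DefaultingStep r (port .clock) n ∧ defaultCount r (port .clock) n = t
  /-- If the machine halts, then the process stabilizes. -/
  stabilizes : (∃ t c, M.configAt hm x t = some c ∧ M.step c = none) →
    ∃ n, Stabilized N e (r n)
  /-- If the process stabilizes, then the machine halts, and the final recovery rates represent
  its final configuration. -/
  final : ∀ n, Stabilized N e (r n) →
    ∃ t c, M.configAt hm x t = some c ∧ M.step c = none ∧ Represents enc port (r n) c

end Simulation

end FinNet

/-! The network simulates an asynchronous Boolean circuit, and the circuit simulates the machine.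

**Circuits as networks.** Each gate is a bank, which is in default if and only if the gate is
true. A positive input of a gate is a CDS that the gate has sold in reference to the input, and a
negative input is a CDS in its favour that outweighs all of its liabilities. A disjunctive gate
has no assets of its own, and defaults with rate `0`. A conjunctive gate with `n` positive inputs
has external assets `n` and a debt of weight `1` on top of its `n` CDSs, so it defaults exactly if
all of its inputs do, and then with rate `n / (n + 1)`; the contracts in reference to it are
scaled by `n + 1` to make up for this. Hence recovery rates take only two values at each bank, and
the runs of the network are exactly the runs of the circuit in which one gate that disagrees with
its inputs changes at a time (`Circuit.recovery_gate`, `Circuit.exists_asyncRun`). A unit of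
external assets at a gate with at most one positive input blocks this gate; in this way the input
is read.

**Independence of the schedule.** A run of the circuit is split into phases (`Phase`). In a phase,
each gate either keeps its value, or may change it in one direction only, and the gates that may
move are monotone in the progress made so far. So, whatever the order, each gate moves at most
once, no enabled gate is disabled again, and the phase can only end by a change of a designated
exit gate, or by becoming quiet (`Phase.run`). The order thus does not matter, provided that the
exit gate is enabled only when everything that the next phase relies on has come to rest, and that
a quiet state in which the exit gate has not moved is impossible.

**The machine.** Two latches run through four modes. In "wipe", the buffer and all signals of the
last cycle are reset; in "evaluate", the next configuration is computed from the stored bits into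
the buffer; in "erase", the stored bits and the evaluation are reset; in "copy", the buffer is
copied to the stored bits. Each of the modes is a phase, and its exit waits for completion
signals: e.g. the evaluation is over when every register has a new value in the buffer, since
there is exactly one pair of gates for each value. `WipeStart.run`, `EvalStart.run`,
`EraseStart.run` and `CopyStart.run` describe the modes, and `EvalStart.cycle` combines them to
one step of the machine. The clock gate rises at the start of an evaluation, when the stored bits
are at rest, except in the first cycle, which loads the input. If the machine halts, the state
register does not get a new value, so the circuit gets quiet during the evaluation, with the final
configuration in the stored bits (`EvalStart.halt`).

The inverter `idle q` of the buffer of a state `q` and the gate `put (.st q)` that it vetoes form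
the condition gadget of the state `q`. There is a bounded number of gates for each pair of a
symbol with a cell, a state or a move, and for each bit, and there are at most `2 ^ k` symbols,
which gives the bound on the number of banks. -/

namespace FinNet

/-! ### Asynchronous Boolean dynamics -/

section Async

variable {G : Type*}

/-- No gate wants to change: `f t v` is the value that the gate `v` computes in the state `t`. -/
def Quiet (f : (G → Prop) → G → Prop) (t : G → Prop) : Prop :=
  ∀ v, f t v ↔ t v

/-- The gate `v` disagrees with the value it computes in `t`, and changes; the new state is `t'`. -/
structure Fire (f : (G → Prop) → G → Prop) (t t' : G → Prop) (v : G) : Prop where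
  excited : ¬ (f t v ↔ t v)
  new : t' v ↔ f t v
  other : ∀ u, u ≠ v → (t' u ↔ t u)

/-- A maximal run of the asynchronous dynamics: one gate changes at a time, in an arbitrary and
possibly unfair order. -/
def AsyncRun (f : (G → Prop) → G → Prop) (t : ℕ → G → Prop) : Prop :=
  ∀ n, (∃ v, Fire f (t n) (t (n + 1)) v) ∨ (Quiet f (t n) ∧ t (n + 1) = t n)

/-- What a gate may do during a phase: keep its value, only rise, or only fall. -/
inductive Trend
  | hold
  | rise
  | fall

/-- The states of a phase that starts in `s`: gates move only as their trend permits, and no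
further than to `d`. -/
structure Between (k : G → Trend) (s d t : G → Prop) : Prop where
  hold : ∀ {v}, k v = .hold → (t v ↔ s v)
  riseLow : ∀ {v}, k v = .rise → s v → t v
  riseHigh : ∀ {v}, k v = .rise → t v → d v
  fallHigh : ∀ {v}, k v = .fall → t v → s v
  fallLow : ∀ {v}, k v = .fall → d v → t v

/-- The invariant of a phase: moreover, no gate wants to move against its trend. -/
structure PhaseInv (f : (G → Prop) → G → Prop) (k : G → Trend) (s d t : G → Prop) : Prop
    extends Between k s d t where
  rise : ∀ {v}, k v = .rise → t v → f t v
  fall : ∀ {v}, k v = .fall → f t v → t v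

/-- A phase of the dynamics. Within it, the gates that may move are monotone with respect to the
progress made so far, so that a gate that is ready to move stays ready and a gate that has moved
does not move back. The gate `l` is the only one that may leave the phase. -/
structure Phase (f : (G → Prop) → G → Prop) (k : G → Trend) (l : G) (s d : G → Prop) : Prop where
  exit : k l = .hold
  baseRise : ∀ {v}, k v = .rise → s v → f s v ∧ d v
  baseFall : ∀ {v}, k v = .fall → (f s v → s v) ∧ (d v → s v)
  topRise : ∀ {t v}, Between k s d t → k v = .rise → f t v → d v
  topFall : ∀ {t v}, Between k s d t → k v = .fall → d v → f t v
  monoRise : ∀ {t t' v}, Between k s d t → Between k s d t' → Between k t d t' →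
    k v = .rise → f t v → f t' v
  monoFall : ∀ {t t' v}, Between k s d t → Between k s d t' → Between k t d t' →
    k v = .fall → f t' v → f t v
  holds : ∀ {t v}, PhaseInv f k s d t → k v = .hold → v ≠ l → (f t v ↔ s v)

variable {f : (G → Prop) → G → Prop} {k : G → Trend} {l : G} {s d : G → Prop}

theorem Phase.inv_start (h : Phase f k l s d) : PhaseInv f k s d s where
  hold _ := Iff.rfl
  riseLow _ := id
  riseHigh hv hs := (h.baseRise hv hs).2
  fallHigh _ := id
  fallLow hv := (h.baseFall hv).2
  rise hv hs := (h.baseRise hv hs).1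
  fall hv := (h.baseFall hv).1

/-- A change of a gate other than the exit gate moves along the trend and keeps the invariant. -/
theorem Phase.inv_step (h : Phase f k l s d) {t t' : G → Prop} {v : G} (ht : PhaseInv f k s d t)
    (hf : Fire f t t' v) (hv : v ≠ l) :
    PhaseInv f k s d t' ∧ ((k v = .rise ∧ ¬ t v ∧ t' v) ∨ (k v = .fall ∧ t v ∧ ¬ t' v)) := by
  have key : (k v = .rise ∧ ¬ t v ∧ f t v) ∨ (k v = .fall ∧ t v ∧ ¬ f t v) := by
    have he := hf.excited
    cases hk : k v with
    | hold => exact absurd ((h.holds ht hk hv).trans (ht.hold hk).symm) he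
    | rise =>
      by_cases h1 : t v
      · exact absurd (iff_of_true (ht.rise hk h1) h1) he
      · exact .inl ⟨rfl, h1, by tauto⟩
    | fall =>
      by_cases h1 : t v
      · exact .inr ⟨rfl, h1, by tauto⟩
      · exact absurd (iff_of_false (fun h2 => h1 (ht.fall hk h2)) h1) he
  have hb : Between k s d t' := by
    refine ⟨fun {u} hu => ?_, fun {u} hu hs => ?_, fun {u} hu hu' => ?_, fun {u} hu hu' => ?_,
      fun {u} hu hd => ?_⟩ <;> by_cases huv : u = v
    · subst huv; simp [hu] at key
    · rw [hf.other u huv, ht.hold hu]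
    · subst huv; exact hf.new.2 (h.monoRise h.inv_start.toBetween ht.toBetween ht.toBetween hu
        (h.baseRise hu hs).1)
    · rw [hf.other u huv]; exact ht.riseLow hu hs
    · subst huv; exact h.topRise ht.toBetween hu (hf.new.1 hu')
    · exact ht.riseHigh hu ((hf.other u huv).1 hu')
    · subst huv; exact ht.fallHigh hu (ht.fall hu (hf.new.1 hu'))
    · exact ht.fallHigh hu ((hf.other u huv).1 hu')
    · subst huv; exact hf.new.2 (h.topFall ht.toBetween hu hd)
    · rw [hf.other u huv]; exact ht.fallLow hu hd
  have hadv : Between k t d t' := by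
    refine ⟨fun {u} hu => (hb.hold hu).trans (ht.hold hu).symm, fun {u} hu hu' => ?_, hb.riseHigh,
      fun {u} hu hu' => ?_, hb.fallLow⟩ <;> by_cases huv : u = v
    · subst huv; exact hf.new.2 (ht.rise hu hu')
    · exact (hf.other u huv).2 hu'
    · subst huv; exact ht.fall hu (hf.new.1 hu')
    · exact (hf.other u huv).1 hu'
  refine ⟨⟨hb, fun {u} hu hu' => h.monoRise ht.toBetween hb hadv hu ?_, fun {u} hu hu' => ?_⟩, ?_⟩
  · by_cases huv : u = v
    · subst huv; exact hf.new.1 hu'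
    · exact ht.rise hu ((hf.other u huv).1 hu')
  · have h1 := h.monoFall ht.toBetween hb hadv hu hu'
    by_cases huv : u = v
    · subst huv; exact hf.new.2 h1
    · exact (hf.other u huv).2 (ht.fall hu h1)
  · rw [hf.new]; exact key

/-- Every run that is in a phase leaves it by a change of the exit gate, or becomes quiet within
it; on the way, the gates move along their trends. -/
theorem Phase.run [Finite G] (h : Phase f k l s d) {t : ℕ → G → Prop} (hr : AsyncRun f t) {n₀ : ℕ}
    (hs : t n₀ = s) :
    ∃ n, n₀ ≤ n ∧ (∀ j, n₀ ≤ j → j ≤ n → PhaseInv f k s d (t j)) ∧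
      (∀ j v, n₀ ≤ j → j < n → (k v = .rise → t j v → t (j + 1) v) ∧
        (k v ≠ .rise → t (j + 1) v → t j v)) ∧
      (Quiet f (t n) ∨ Fire f (t n) (t (n + 1)) l) := by
  classical
  have := Fintype.ofFinite G
  -- The number of gates that can still move decreases with every change within the phase.
  suffices H : ∀ c n₁, PhaseInv f k s d (t n₁) →
      (Finset.univ.filter fun v => (k v = .rise ∧ ¬ t n₁ v) ∨ (k v = .fall ∧ t n₁ v)).card = c →
      ∃ n, n₁ ≤ n ∧ (∀ j, n₁ ≤ j → j ≤ n → PhaseInv f k s d (t j)) ∧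
      (∀ j v, n₁ ≤ j → j < n → (k v = .rise → t j v → t (j + 1) v) ∧
        (k v ≠ .rise → t (j + 1) v → t j v)) ∧
      (Quiet f (t n) ∨ Fire f (t n) (t (n + 1)) l) from H _ n₀ (hs ▸ h.inv_start) rfl
  intro c
  induction c using Nat.strong_induction_on with
  | _ c ih =>
    intro n₁ hi hc
    have hleave : (Quiet f (t n₁) ∨ Fire f (t n₁) (t (n₁ + 1)) l) → ∃ n, n₁ ≤ n ∧
        (∀ j, n₁ ≤ j → j ≤ n → PhaseInv f k s d (t j)) ∧
        (∀ j v, n₁ ≤ j → j < n → (k v = .rise → t j v → t (j + 1) v) ∧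
          (k v ≠ .rise → t (j + 1) v → t j v)) ∧
        (Quiet f (t n) ∨ Fire f (t n) (t (n + 1)) l) := fun hq =>
      ⟨n₁, le_rfl, fun j h1 h2 => by rwa [le_antisymm h2 h1], fun j v h1 h2 => by omega, hq⟩
    rcases hr n₁ with ⟨v, hv⟩ | ⟨hq, -⟩
    swap
    · exact hleave (.inl hq)
    by_cases hvl : v = l
    · subst hvl; exact hleave (.inr hv)
    obtain ⟨hi', hmove⟩ := h.inv_step hi hv hvl
    have hother : ∀ u, u ≠ v → (t (n₁ + 1) u ↔ t n₁ u) := hv.other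
    have hlt : (Finset.univ.filter fun v => (k v = .rise ∧ ¬ t (n₁ + 1) v) ∨
        (k v = .fall ∧ t (n₁ + 1) v)).card < c := by
      rw [← hc]
      refine Finset.card_lt_card ⟨fun u hu => ?_, fun hsub => ?_⟩
      · simp only [Finset.mem_filter, Finset.mem_univ, true_and] at hu ⊢
        by_cases huv : u = v
        · subst huv; grind
        · rwa [hother u huv] at hu
      · have hmem : v ∈ Finset.univ.filter fun v => (k v = .rise ∧ ¬ t n₁ v) ∨
            (k v = .fall ∧ t n₁ v) := by
          simp only [Finset.mem_filter, Finset.mem_univ, true_and]; tauto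
        have := hsub hmem
        simp only [Finset.mem_filter, Finset.mem_univ, true_and] at this
        grind
    obtain ⟨n, hn, hinv, hmono, hend⟩ := ih _ hlt (n₁ + 1) hi' rfl
    refine ⟨n, by omega, fun j h1 h2 => ?_, fun j u h1 h2 => ?_, hend⟩
    · rcases h1.eq_or_lt with rfl | h1
      · exact hi
      · exact hinv j h1 h2
    · rcases h1.eq_or_lt with rfl | h1
      · by_cases huv : u = v
        · subst huv; grind
        · rw [hother u huv]; tauto
      · exact hmono j u h1 h2

/-- Nothing changes after a quiet state. -/
theorem AsyncRun.eq_of_quiet {t : ℕ → G → Prop} (hr : AsyncRun f t) {a b : ℕ} (hab : a ≤ b)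
    (hq : Quiet f (t a)) : t b = t a := by
  induction b, hab using Nat.le_induction with
  | base => rfl
  | succ b hab ih =>
    rcases hr b with ⟨v, hv⟩ | ⟨-, h⟩
    · exact absurd (ih ▸ hq v) hv.excited
    · rw [h, ih]

end Async

/-! ### Circuits of gates -/

/-- A circuit of threshold gates with unbounded fan-in. A gate is vetoed by each of its inputs in
`neg`. Without a veto, it is true if all of its inputs in `pos` are (for a conjunctive gate), or if
one of them is (for the other gates). -/
structure Circuit (G : Type*) where
  conj : G → Prop
  pos : G → Set G
  neg : G → Set G
  pos_irrefl : ∀ v, v ∉ pos v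
  neg_irrefl : ∀ v, v ∉ neg v

section Circuit

variable {G : Type*} (C : Circuit G)

/-- The value that the gate `v` computes in the state `t`, when the gates in `blk` are blocked from
outside. -/
def Circuit.eval (blk : Set G) (t : G → Prop) (v : G) : Prop :=
  v ∉ blk ∧ ((C.conj v ∧ ∀ w ∈ C.pos v, t w) ∨ (¬ C.conj v ∧ ∃ w ∈ C.pos v, t w)) ∧
    ∀ w ∈ C.neg v, ¬ t w

variable {C} {k : G → Trend} {d t t' : G → Prop} {blk : Set G} {v : G}

/-- A gate is monotone if its positive inputs do not fall and its negative inputs do not rise. -/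
theorem Circuit.eval_mono (h : Between k t d t') (hp : ∀ w ∈ C.pos v, k w ≠ .fall)
    (hn : ∀ w ∈ C.neg v, k w ≠ .rise) (hv : C.eval blk t v) : C.eval blk t' v := by
  have h1 : ∀ w ∈ C.pos v, t w → t' w := fun w hw htw => by
    cases hk : k w with
    | hold => exact (h.hold hk).2 htw
    | rise => exact h.riseLow hk htw
    | fall => exact absurd hk (hp w hw)
  have h2 : ∀ w ∈ C.neg v, ¬ t w → ¬ t' w := fun w hw htw => by
    cases hk : k w with
    | hold => rwa [h.hold hk]
    | rise => exact absurd hk (hn w hw)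
    | fall => exact fun h' => htw (h.fallHigh hk h')
  obtain ⟨hb, hpos, hneg⟩ := hv
  refine ⟨hb, hpos.imp (fun hh => ⟨hh.1, fun w hw => h1 w hw (hh.2 w hw)⟩)
    (fun ⟨hc, w, hw, hh⟩ => ⟨hc, w, hw, h1 w hw hh⟩), fun w hw => h2 w hw (hneg w hw)⟩

theorem Circuit.eval_anti (h : Between k t d t') (hp : ∀ w ∈ C.pos v, k w ≠ .rise)
    (hn : ∀ w ∈ C.neg v, k w ≠ .fall) (hv : C.eval blk t' v) : C.eval blk t v := by
  have h1 : ∀ w ∈ C.pos v, t' w → t w := fun w hw htw => by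
    cases hk : k w with
    | hold => exact (h.hold hk).1 htw
    | rise => exact absurd hk (hp w hw)
    | fall => exact h.fallHigh hk htw
  have h2 : ∀ w ∈ C.neg v, ¬ t' w → ¬ t w := fun w hw htw => by
    cases hk : k w with
    | hold => rwa [← h.hold hk]
    | rise => exact fun h' => htw (h.riseLow hk h')
    | fall => exact absurd hk (hn w hw)
  obtain ⟨hb, hpos, hneg⟩ := hv
  refine ⟨hb, hpos.imp (fun hh => ⟨hh.1, fun w hw => h1 w hw (hh.2 w hw)⟩)
    (fun ⟨hc, w, hw, hh⟩ => ⟨hc, w, hw, h1 w hw hh⟩), fun w hw => h2 w hw (hneg w hw)⟩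

/-- The circuit with its gates renamed. -/
def Circuit.map {ι : Type*} (C : Circuit G) (e : G ≃ ι) : Circuit ι where
  conj v := C.conj (e.symm v)
  pos v := {w | e.symm w ∈ C.pos (e.symm v)}
  neg v := {w | e.symm w ∈ C.neg (e.symm v)}
  pos_irrefl _ := C.pos_irrefl _
  neg_irrefl _ := C.neg_irrefl _

theorem Circuit.eval_map {ι : Type*} (e : G ≃ ι) (blk : Set ι) (t : ι → Prop) (v : G) :
    (C.map e).eval blk t (e v) ↔ C.eval (e ⁻¹' blk) (t ∘ e) v := by
  simp [Circuit.eval, Circuit.map, e.surjective.forall, e.surjective.exists]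

end Circuit

/-! ### Circuits as financial networks -/

/-- The banks of the network of a circuit: one for each gate, a source `none` that pays for all
credit default swaps into gates, and a sink that receives the payments of all gates. -/
abbrev Bank (ι : Type*) := Option (Option ι)

namespace Bank

variable {ι : Type*}

/-- The creditor of all gates. -/
abbrev sink : Bank ι := some none
/-- The bank of the gate `v`. -/
abbrev gate (v : ι) : Bank ι := some (some v)

end Bank

section NetworkOfCircuit

open Bank

variable {ι : Type*} (C : Circuit ι)

open Classical in
/-- A gate that is true is a bank in default that fails to pay the fraction `1 / K` of its
liabilities, where `K` is this number. So the CDSs of weight `K` in reference to it are worth `1`.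
Gates that are not conjunctive default with recovery rate `0`. -/
noncomputable def Circuit.scale (v : ι) : ℕ :=
  if C.conj v then (C.pos v).ncard + 1 else 1

open Classical in
/-- The contracts of the network of a circuit. A positive input of a gate increases its liabilities
by `1` when it defaults, and a negative input increases its assets by more than these liabilities
can be. A conjunctive gate has a debt of weight `1` on top; so, if it owns `n` units for `n`
positive inputs, it defaults exactly if all of these default. -/
noncomputable def Circuit.contracts : Contracts (Bank ι) where
  debt
    | some (some v), some none => if C.conj v then 1 else 0
    | _, _ => 0
  cds
    | some (some v), some none, some (some w) => if w ∈ C.pos v then C.scale w else 0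
    | none, some (some v), some (some w) =>
        if w ∈ C.neg v then C.scale w * ((C.pos v).ncard + 1) else 0
    | _, _, _ => 0
  debt_self u := by rcases u with _ | _ | u <;> rfl
  cds_self u w := by rcases u with _ | _ | u <;> rcases w with _ | _ | w <;> rfl
  cds_ref_debtor u v := by
    rcases u with _ | _ | u <;> rcases v with _ | _ | v <;> simp [C.pos_irrefl]
  cds_ref_creditor u v := by
    rcases u with _ | _ | u <;> rcases v with _ | _ | v <;> simp [C.neg_irrefl]

variable [Fintype ι]

open Classical in
/-- The external assets of the network of a circuit. The source can pay all of its liabilities. -/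
noncomputable def Circuit.external : Bank ι → ℝ≥0
  | none => ∑ v, ∑ w, if w ∈ C.neg v then C.scale w * ((C.pos v).ncard + 1) else 0
  | some none => 0
  | some (some v) => if C.conj v then (C.pos v).ncard else 0

open Classical in
/-- The external assets, with one more unit for each blocked gate. -/
noncomputable def Circuit.externalBlocked (blk : Set ι) (b : Bank ι) : ℝ≥0 :=
  C.external b + if ∃ v ∈ blk, b = gate v then 1 else 0

open Classical in
/-- The recovery rates that belong to a state of the circuit; the source and the sink never
default. -/
noncomputable def Circuit.rates (t : ι → Prop) : Bank ι → ℝ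
  | some (some v) => if t v then 1 - 1 / C.scale v else 1
  | _ => 1

omit [Fintype ι] in
theorem Circuit.scale_pos (v : ι) : (0 : ℝ) < C.scale v := by
  unfold scale; split_ifs <;> positivity

omit [Fintype ι] in
theorem Circuit.rates_gate_lt_one (t : ι → Prop) (v : ι) : C.rates t (gate v) < 1 ↔ t v := by
  have := C.scale_pos v
  by_cases h : t v <;> simp [rates, h, this]

omit [Fintype ι] in
theorem Circuit.rates_gate_eq_one (t : ι → Prop) (v : ι) : C.rates t (gate v) = 1 ↔ ¬ t v := by
  have := C.scale_pos v
  by_cases h : t v <;> simp [rates, h, this.ne']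

open Classical in
theorem Circuit.liability_gate (t : ι → Prop) (v : ι) :
    liability C.contracts (C.rates t) (gate v) =
      (if C.conj v then 1 else 0) + ((Finset.univ.filter fun w => w ∈ C.pos v ∧ t w).card : ℝ) := by
  have h : ∀ w, ((if w ∈ C.pos v then (C.scale w : ℝ≥0) else 0 : ℝ≥0) : ℝ) *
      (1 - if t w then 1 - 1 / (C.scale w : ℝ) else 1) = if w ∈ C.pos v ∧ t w then 1 else 0 := by
    intro w
    have := (C.scale_pos w).ne'
    by_cases h1 : w ∈ C.pos v <;> by_cases h2 : t w <;> simp [h1, h2, this]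
  simp only [liability, liabilityTo, Fintype.sum_option, contracts, rates, h]
  simp [apply_ite]

open Classical in
theorem Circuit.assets_gate (e : Bank ι → ℝ≥0) (t : ι → Prop) (v : ι) :
    assets C.contracts e (C.rates t) (gate v) =
      e (gate v) + ((C.pos v).ncard + 1) *
        ((Finset.univ.filter fun w => w ∈ C.neg v ∧ t w).card : ℝ) := by
  have h : ∀ w, ((if w ∈ C.neg v then (C.scale w * ((C.pos v).ncard + 1) : ℝ≥0) else 0 : ℝ≥0) : ℝ) *
      (1 - if t w then 1 - 1 / (C.scale w : ℝ) else 1) =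
      ((C.pos v).ncard + 1) * if w ∈ C.neg v ∧ t w then 1 else 0 := by
    intro w
    have := (C.scale_pos w).ne'
    by_cases h1 : w ∈ C.neg v <;> by_cases h2 : t w <;> simp [h1, h2]
    field_simp
  simp only [assets, payment, liabilityTo, Fintype.sum_option, contracts, rates, h]
  simp only [← Finset.mul_sum, Finset.sum_boole]
  simp

/-- In a state of the circuit, each gate computes its value by the rule for the recovery rates. -/
theorem Circuit.recovery_gate {blk : Set ι}
    (hblk : ∀ v ∈ blk, ¬ C.conj v ∧ (C.pos v).ncard ≤ 1) (t : ι → Prop) (v : ι) :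
    recovery (assets C.contracts (C.externalBlocked blk) (C.rates t) (gate v))
      (liability C.contracts (C.rates t) (gate v)) = C.rates (C.eval blk t) (gate v) := by
  classical
  have hcard : (C.pos v).ncard = (Finset.univ.filter fun w => w ∈ C.pos v).card := by
    rw [Set.ncard_eq_toFinset_card']
    congr 1; ext; simp
  have hsub : (Finset.univ.filter fun w => w ∈ C.pos v ∧ t w) ⊆
      Finset.univ.filter fun w => w ∈ C.pos v := fun w hw => by
    simp only [Finset.mem_filter] at hw ⊢; tauto
  have hle := Finset.card_le_card hsub
  rw [C.liability_gate, C.assets_gate]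
  set p := (Finset.univ.filter fun w => w ∈ C.pos v ∧ t w).card with hp
  set q := (Finset.univ.filter fun w => w ∈ C.neg v ∧ t w).card with hq
  set n := (C.pos v).ncard with hn
  rw [← hcard] at hle
  have hle' : (p : ℝ) ≤ n := by exact_mod_cast hle
  have hall : (∀ w ∈ C.pos v, t w) ↔ p = n := by
    rw [hcard]
    constructor
    · intro h
      rw [hp]; congr 1; ext w; simp only [Finset.mem_filter]
      have := h w; tauto
    · intro h w hw
      have := Finset.eq_of_subset_of_card_le hsub h.ge
      have : w ∈ Finset.univ.filter fun w => w ∈ C.pos v ∧ t w := by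
        rw [this]; simpa using hw
      simpa using (Finset.mem_filter.1 this).2.2
  have hex : (∃ w ∈ C.pos v, t w) ↔ 0 < p := by
    rw [hp, Finset.card_pos]
    constructor
    · rintro ⟨w, h1, h2⟩; exact ⟨w, by simp [h1, h2]⟩
    · rintro ⟨w, hw⟩; exact ⟨w, by simpa using hw⟩
  have hveto : (∀ w ∈ C.neg v, ¬ t w) ↔ q = 0 := by
    rw [hq, Finset.card_eq_zero, Finset.filter_eq_empty_iff]
    constructor
    · intro h w _ hw; exact h w hw.1 hw.2
    · intro h w h1 h2; exact h (Finset.mem_univ w) ⟨h1, h2⟩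
  have hb : (∃ u ∈ blk, gate v = gate u) ↔ v ∈ blk := by simp
  simp only [externalBlocked, external, rates, eval, hall, hex, hveto, hb, scale, ← hn]
  have hq0 : (0 : ℝ) ≤ q := Nat.cast_nonneg q
  by_cases hv : v ∈ blk
  · obtain ⟨h1, h2⟩ := hblk v hv
    have h3 : (p : ℝ) ≤ 1 := by exact_mod_cast hle.trans h2
    have h4 : (p : ℝ) ≤ 1 + (n + 1) * q := by nlinarith
    simp [hv, h1, recovery, h4]
  · by_cases hq1 : q = 0
    · by_cases h1 : C.conj v
      · by_cases h2 : p = n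
        · have h3 : (1 : ℝ) + n ≠ 0 := by positivity
          have h4 : (n : ℝ) + 1 ≠ 0 := by positivity
          have h5 : ¬ ((1 : ℝ) + n ≤ n) := by linarith
          simp only [hv, hq1, h1, h2, recovery]
          simp only [NNReal.coe_natCast, if_true, if_false, not_false_eq_true, and_true,
            not_true_eq_false, false_and, or_false, add_zero,
            Nat.cast_zero, mul_zero, h5, Nat.cast_add, Nat.cast_one]
          field_simp
          ring
        · have : p + 1 ≤ n := by omega
          have h3 : (1 : ℝ) + p ≤ n := by exact_mod_cast (by omega : 1 + p ≤ n)
          simp [hv, hq1, h1, h2, recovery, h3]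
      · by_cases h2 : 0 < p
        · have : ¬ ((p : ℝ) ≤ 0) := by simpa using h2.ne'
          simp [hv, hq1, h1, h2, recovery, this]
        · have : p = 0 := by omega
          simp [hv, hq1, h1, this, recovery]
    · have h1 : (1 : ℝ) ≤ q := by exact_mod_cast Nat.one_le_iff_ne_zero.2 hq1
      have h2 : (1 : ℝ) + p ≤ (n + 1) * q := by nlinarith
      by_cases h3 : C.conj v
      · have h4 : (1 : ℝ) + p ≤ n + (n + 1) * q := by
          have : (0 : ℝ) ≤ n := Nat.cast_nonneg n
          linarith
        simp [hv, hq1, h3, recovery, h4]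
      · have h4 : (p : ℝ) ≤ (n + 1) * q := by linarith
        simp [hv, hq1, h3, recovery, h4]

omit [Fintype ι] in
theorem Circuit.rates_mem (t : ι → Prop) (b : Bank ι) : 0 ≤ C.rates t b ∧ C.rates t b ≤ 1 := by
  classical
  rcases b with _ | _ | v
  · simp [rates]
  · simp [rates]
  · have h : (1 : ℝ) ≤ C.scale v := by unfold scale; split_ifs <;> simp
    have h' : (C.scale v : ℝ)⁻¹ ≤ 1 := inv_le_one_of_one_le₀ h
    have h'' : (0 : ℝ) ≤ (C.scale v : ℝ)⁻¹ := by positivity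
    by_cases ht : t v
    · simp only [rates, ht, if_true, one_div]
      constructor <;> linarith
    · simp [rates, ht]

theorem Circuit.liabilityTo_nonneg (t : ι → Prop) (u v : Bank ι) :
    0 ≤ liabilityTo C.contracts (C.rates t) u v :=
  add_nonneg (NNReal.coe_nonneg _) (Finset.sum_nonneg fun w _ =>
    mul_nonneg (NNReal.coe_nonneg _) (by linarith [(C.rates_mem t w).2]))

theorem Circuit.le_assets (e : Bank ι → ℝ≥0) (t : ι → Prop) (v : Bank ι) :
    (e v : ℝ) ≤ assets C.contracts e (C.rates t) v :=
  le_add_of_nonneg_right (Finset.sum_nonneg fun u _ =>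
    mul_nonneg (C.rates_mem t u).1 (C.liabilityTo_nonneg t u v))

theorem Circuit.recovery_eq {blk : Set ι}
    (hblk : ∀ v ∈ blk, ¬ C.conj v ∧ (C.pos v).ncard ≤ 1) (t : ι → Prop) (b : Bank ι) :
    recovery (assets C.contracts (C.externalBlocked blk) (C.rates t) b)
      (liability C.contracts (C.rates t) b) = C.rates (C.eval blk t) b := by
  classical
  have hle := C.le_assets (C.externalBlocked blk) t b
  have hext : (C.external b : ℝ) ≤ C.externalBlocked blk b := by
    simp [externalBlocked]
  rcases b with _ | _ | v
  · refine if_pos (le_trans ?_ (hext.trans hle))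
    simp only [liability, liabilityTo, Fintype.sum_option, contracts, external]
    simp only [NNReal.coe_zero, zero_mul, Finset.sum_const_zero, add_zero, zero_add, NNReal.coe_sum]
    refine Finset.sum_le_sum fun v _ => Finset.sum_le_sum fun w _ => ?_
    exact mul_le_of_le_one_right (NNReal.coe_nonneg _)
      (by linarith [(C.rates_mem t (gate w)).1])
  · refine if_pos (le_trans (le_of_eq ?_) ((NNReal.coe_nonneg _).trans hle))
    simp [liability, liabilityTo, contracts]
  · exact C.recovery_gate hblk t v

variable {C} {blk : Set ι} {r : ℕ → Bank ι → ℝ}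

omit [Fintype ι] in
theorem Circuit.rates_inj {t t' : ι → Prop} :
    C.rates t = C.rates t' ↔ t = t' := by
  refine ⟨fun h => funext fun v => ?_, fun h => h ▸ rfl⟩
  have := C.rates_gate_eq_one t v
  rw [h, C.rates_gate_eq_one] at this
  exact propext (by tauto)

theorem Circuit.stabilized_iff (hblk : ∀ v ∈ blk, ¬ C.conj v ∧ (C.pos v).ncard ≤ 1)
    (t : ι → Prop) : Stabilized C.contracts (C.externalBlocked blk) (C.rates t) ↔
      Quiet (C.eval blk) t := by
  simp only [Stabilized, Updatable, C.recovery_eq hblk, not_not]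
  rw [← funext_iff, Circuit.rates_inj]
  exact ⟨fun h v => by rw [← h], fun h => funext fun v => propext (h v).symm⟩

/-- The runs of the network are the asynchronous runs of the circuit. -/
theorem Circuit.exists_asyncRun (hblk : ∀ v ∈ blk, ¬ C.conj v ∧ (C.pos v).ncard ≤ 1)
    (hr : IsRun C.contracts (C.externalBlocked blk) r) :
    ∃ t : ℕ → ι → Prop, (∀ v, ¬ t 0 v) ∧ AsyncRun (C.eval blk) t ∧ ∀ n, r n = C.rates (t n) := by
  classical
  have hex : ∀ n, ∃ t : ι → Prop, r n = C.rates t := by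
    intro n
    induction n with
    | zero =>
      refine ⟨fun _ => False, funext fun b => ?_⟩
      rw [hr.1]; rcases b with _ | _ | v <;> simp [rates]
    | succ n ih =>
      obtain ⟨t, ht⟩ := ih
      rcases hr.2 n with ⟨b, -, hb, ho⟩ | ⟨-, h⟩
      · rw [ht, C.recovery_eq hblk] at hb
        refine ⟨fun v => if b = gate v then C.eval blk t v else t v, funext fun u => ?_⟩
        by_cases hu : u = b
        · subst hu; rw [hb]
          rcases u with _ | _ | v <;> simp [rates]
        · rw [ho u hu, ht]
          rcases u with _ | _ | v
          · rfl
          · rfl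
          · simp [rates, Ne.symm hu]
      · exact ⟨t, h.trans ht⟩
  choose t ht using hex
  refine ⟨t, fun v => ?_, fun n => ?_, ht⟩
  · rw [← C.rates_gate_eq_one, ← ht, hr.1]
  · rcases hr.2 n with ⟨b, hup, hb, ho⟩ | ⟨hst, h⟩
    · rw [Updatable, ht, C.recovery_eq hblk] at hup
      rw [ht, ht, C.recovery_eq hblk] at hb
      rcases b with _ | _ | v
      · exact absurd rfl hup
      · exact absurd rfl hup
      refine .inl ⟨v, fun h => hup ?_, ?_, fun u hu => ?_⟩
      · simp [rates, h]
      · rw [← C.rates_gate_lt_one (t (n + 1)), hb, C.rates_gate_lt_one]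
      · have := ho (gate u) (by simpa using hu)
        rw [← C.rates_gate_lt_one (t (n + 1)), ← C.rates_gate_lt_one (t n), ← ht, ← ht, this]
    · rw [ht, C.stabilized_iff hblk] at hst
      exact .inr ⟨hst, Circuit.rates_inj.1 (by rw [← ht, ← ht, h])⟩

/-! ### The gadgets in the network of a circuit -/

theorem Circuit.isStableBit (C : Circuit ι) {v₁ v₂ : ι} (h₁ : ¬ C.conj v₁) (h₂ : ¬ C.conj v₂)
    (p₁ : v₂ ∈ C.pos v₁) (p₂ : v₁ ∈ C.pos v₂) (n₁ : v₂ ∉ C.neg v₁) (n₂ : v₁ ∉ C.neg v₂) :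
    IsStableBit C.contracts C.external (gate v₁) (gate v₂) where
  ext₁ := by simp [external, h₁]
  ext₂ := by simp [external, h₂]
  cds₁ := ⟨sink, by simp only [contracts, if_pos p₁]; exact_mod_cast C.scale_pos v₂⟩
  cds₂ := ⟨sink, by simp only [contracts, if_pos p₂]; exact_mod_cast C.scale_pos v₁⟩
  noDebt₁ x := by rcases x with _ | _ | x <;> simp [contracts, h₁]
  noDebt₂ x := by rcases x with _ | _ | x <;> simp [contracts, h₂]
  noPay₁ x := by rcases x with _ | _ | x <;> simp [contracts, n₁]
  noPay₂ x := by rcases x with _ | _ | x <;> simp [contracts, n₂]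

/-- A pair of an inverter `u` and a gate `w` that `u` vetoes is a condition gadget. -/
theorem Circuit.isConditionGadget (C : Circuit ι) {u w p g : ι} (hu : C.conj u) (hw : ¬ C.conj w)
    (hp : ¬ C.conj p) (hg : ¬ C.conj g) (pu : C.pos u = ∅) (nu : C.neg u = {p})
    (pw : C.pos w = {g}) (nw : C.neg w = {u}) :
    IsConditionGadget C.contracts C.external (gate u) (gate w) where
  extU := by simp [external, pu]
  extW := by simp [external, hw]
  weights := ⟨1, one_pos, by simp [contracts, hu], by
    simp [contracts, pw, nw, scale, hu, pu, one_add_one_eq_two]⟩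
  inU x := by rcases x with _ | _ | x <;> simp [contracts]
  posCond z := by
    rcases z with _ | _ | z
    · simp [contracts]
    · simp [contracts]
    · by_cases hz : z = p
      · subst hz; simp [contracts, Fintype.sum_option, nu, pu, scale, hp]
      · simp [contracts, Fintype.sum_option, nu, hz]
  negCond z := by
    rcases z with _ | _ | z <;> simp [contracts, Fintype.sum_option, pu]
  outW := by
    simp only [contracts, Fintype.sum_option, hw, if_false, Finset.sum_const_zero, add_zero,
      zero_add]
    rw [Finset.sum_eq_single g (fun x _ hx => if_neg (by simpa [pw] using hx)) (by simp)]
    simp [pw, scale, hg]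
  inW x := by
    refine ⟨by rcases x with _ | _ | x <;> simp [contracts], fun y hy => ?_⟩
    rcases x with _ | _ | x <;> rcases y with _ | _ | y <;> simp [contracts, nw]
    intro h; exact absurd (by rw [h]) hy

theorem Circuit.isStateGadget (C : Circuit ι) {u w v₁ v₂ : ι}
    (hc : IsConditionGadget C.contracts C.external (gate u) (gate w))
    (hb : IsStableBit C.contracts C.external (gate v₁) (gate v₂)) (hw : w ∈ C.pos v₁) :
    IsStateGadget C.contracts C.external (gate u) (gate w) (gate v₁) (gate v₂) where
  cond := hc
  bit := hb
  trigger := ⟨sink, by simp only [contracts, if_pos hw]; exact_mod_cast C.scale_pos w⟩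

end NetworkOfCircuit

/-! ### Configurations as collections of values -/

/-- The registers of a machine: the tape cells, the head position and the state. -/
inductive Field (m : ℕ)
  | cell (i : Fin m)
  | head
  | state

/-- The pairs of a register and a possible value of it. -/
inductive Value (Q Γ : Type*) (m : ℕ)
  | sym (i : Fin m) (a : Γ)
  | pos (i : Fin m)
  | st (q : Q)

/-- The bits in which the registers are stored. -/
inductive Bit (Q : Type*) (m k : ℕ)
  | cell (i : Fin m) (j : Fin k)
  | addr (l : Fin (Nat.clog 2 m))
  | ctrl (q : Q)

variable {Q Γ : Type*} {m k : ℕ}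

/-- The register that a value belongs to. -/
def Value.field : Value Q Γ m → Field m
  | .sym i _ => .cell i
  | .pos _ => .head
  | .st _ => .state

/-- The bits of its register that are `1` in the encoding of a value. -/
def Value.ones (enc : Γ → Fin k → Bool) : Value Q Γ m → Set (Bit Q m k)
  | .sym i a => {b | ∃ j, enc a j = true ∧ b = .cell i j}
  | .pos i => {b | ∃ l : Fin _, (i : ℕ).testBit l = true ∧ b = .addr l}
  | .st q => {.ctrl q}

/-- The bits of its register that are `0` in the encoding of a value. -/
def Value.zeros (enc : Γ → Fin k → Bool) : Value Q Γ m → Set (Bit Q m k)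
  | .sym i a => {b | ∃ j, enc a j = false ∧ b = .cell i j}
  | .pos i => {b | ∃ l : Fin _, (i : ℕ).testBit l = false ∧ b = .addr l}
  | .st q => {b | ∃ q', q ≠ q' ∧ b = .ctrl q'}

/-- The values of the registers in a configuration. -/
def Config.Has (c : Config Q Γ m) : Value Q Γ m → Prop
  | .sym i a => c.tape i = a
  | .pos i => c.head = i
  | .st q => c.state = q

/-- The values of the bits in a configuration. -/
def Config.HasBit (enc : Γ → Fin k → Bool) (c : Config Q Γ m) : Bit Q m k → Prop
  | .cell i j => enc (c.tape i) j = true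
  | .addr l => (c.head : ℕ).testBit l = true
  | .ctrl q => q = c.state

theorem Config.hasBit_iff (enc : Γ → Fin k → Bool) (c : Config Q Γ m) (b : Bit Q m k) :
    c.HasBit enc b ↔ ∃ v, c.Has v ∧ b ∈ v.ones enc := by
  constructor
  · intro h
    cases b with
    | cell i j => exact ⟨.sym i (c.tape i), rfl, j, h, rfl⟩
    | addr l => exact ⟨.pos c.head, rfl, l, h, rfl⟩
    | ctrl q => exact ⟨.st c.state, rfl, congrArg _ h⟩
  · rintro ⟨v, hv, hb⟩
    cases v <;> simp only [Has] at hv <;> subst hv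
    · obtain ⟨j, hj, rfl⟩ := hb; exact hj
    · obtain ⟨j, hj, rfl⟩ := hb; exact hj
    · obtain rfl := hb; rfl

/-- A configuration has a value if and only if it has the bits of this value. -/
theorem Config.has_iff {enc : Γ → Fin k → Bool} (henc : Function.Injective enc)
    (c : Config Q Γ m) (v : Value Q Γ m) :
    c.Has v ↔ (∀ b ∈ v.ones enc, c.HasBit enc b) ∧ ∀ b ∈ v.zeros enc, ¬ c.HasBit enc b := by
  constructor
  · intro hv
    cases v <;> simp only [Has] at hv <;> subst hv
    · exact ⟨by rintro _ ⟨j, hj, rfl⟩; exact hj, by rintro _ ⟨j, hj, rfl⟩; simp [HasBit, hj]⟩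
    · exact ⟨by rintro _ ⟨j, hj, rfl⟩; exact hj, by rintro _ ⟨j, hj, rfl⟩; simp [HasBit, hj]⟩
    · exact ⟨by rintro _ rfl; rfl, by rintro _ ⟨j, hj, rfl⟩; simpa [HasBit] using hj.symm⟩
  · rintro ⟨h1, h0⟩
    cases v with
    | sym i a =>
      refine henc (funext fun j => ?_)
      cases hj : enc a j with
      | true => exact h1 _ ⟨j, hj, rfl⟩
      | false => simpa [HasBit] using h0 _ ⟨j, hj, rfl⟩
    | pos i =>
      refine Fin.ext (Nat.eq_of_testBit_eq fun l => ?_)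
      have hlt : ∀ i : Fin m, (i : ℕ) < 2 ^ Nat.clog 2 m := fun i =>
        i.2.trans_le (Nat.le_pow_clog one_lt_two m)
      by_cases hl : l < Nat.clog 2 m
      · cases hj : (i : ℕ).testBit l with
        | true => exact h1 _ ⟨⟨l, hl⟩, hj, rfl⟩
        | false => simpa [HasBit] using h0 _ ⟨⟨l, hl⟩, hj, rfl⟩
      · have hp : 2 ^ Nat.clog 2 m ≤ 2 ^ l := Nat.pow_le_pow_right two_pos (not_lt.1 hl)
        rw [Nat.testBit_lt_two_pow ((hlt _).trans_le hp),
          Nat.testBit_lt_two_pow ((hlt _).trans_le hp)]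
    | st q => exact (h1 (.ctrl q) rfl).symm

theorem Config.exists_has (c : Config Q Γ m) (f : Field m) : ∃ v, v.field = f ∧ c.Has v := by
  cases f with
  | cell i => exact ⟨.sym i (c.tape i), rfl, rfl⟩
  | head => exact ⟨.pos c.head, rfl, rfl⟩
  | state => exact ⟨.st c.state, rfl, rfl⟩

theorem Config.Has.eq {c : Config Q Γ m} {v w : Value Q Γ m} (hv : c.Has v) (hw : c.Has w)
    (h : v.field = w.field) : v = w := by
  cases v <;> cases w <;> simp_all [Config.Has, Value.field]

/-! ### The circuit of a machine -/

/-- The gates of the circuit that simulates a machine.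

Control: the latches `fetch` and `write` (pairs of gates, with `fetch₂` and `write₂` as outputs) run
through the four modes of a cycle: "wipe" (both off), "evaluate" (`fetch` on), "erase" (both on),
"copy" (`write` on). The latch `loaded` is set in the first cycle, whose evaluation reads the input
instead of the stored bits. Each mode ends by a change of one of the two latches, caused by one of
`fetchOn`, `writeOn`, `fetchOff` and `writeOff`.

Evaluation: `boot` starts the evaluation of the first cycle, with the gates `input` and `load`;
`clock` starts that of the later cycles, with the gates from `sense` to `move`. The gate `live`
tells that one of them has happened.

Storage: the latch pairs `buf₁`, `buf₂` hold the next configuration, with one pair for each possible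
value of each register; the pairs `mem₁`, `mem₂` hold the bits of the current configuration. -/
inductive Gate (Q Γ : Type*) (m k : ℕ)
  | fetch₁ | fetch₂ | write₁ | write₂ | loaded₁ | loaded₂
  | fetchOn | fetchOff | writeOn | writeOff
  | wipe | erase | copy
  | boot | clock | live
  | input (i : Fin m) (a : Γ)
  | load (i : Fin m) (a : Γ)
  | sense (v : Value Q Γ m)
  | away (i : Fin m)
  | hit (i : Fin m) (a : Γ)
  | scan (a : Γ)
  | rule (q : Q) (a : Γ)
  | act (a : Γ) (d : Move)
  | keep (i : Fin m) (a : Γ)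
  | move (i : Fin m) (a : Γ) (d : Move)
  | buf₁ (v : Value Q Γ m)
  | buf₂ (v : Value Q Γ m)
  | full (f : Field m)
  | put (v : Value Q Γ m)
  | done (v : Value Q Γ m)
  | stored (f : Field m)
  | mem₁ (b : Bit Q m k)
  | mem₂ (b : Bit Q m k)
  | idle (q : Q)

namespace Gate

/-- The gates of the evaluation. -/
def IsData : Gate Q Γ m k → Prop
  | boot | clock | live | input _ _ | load _ _ | sense _ | away _ | hit _ _ | scan _ | rule _ _
  | act _ _ | keep _ _ | move _ _ _ => True
  | _ => False

/-- The gates that the mode "wipe" resets. -/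
def IsStale : Gate Q Γ m k → Prop
  | buf₁ _ | buf₂ _ | full _ | copy | put _ | done _ | stored _ | writeOff => True
  | _ => False

/-- The conjunctive gates. -/
def AllOf : Gate Q Γ m k → Prop
  | fetchOn | fetchOff | writeOn | writeOff | wipe | erase | clock | load _ _ | sense _ | hit _ _
  | rule _ _ | keep _ _ | move _ _ _ | put (.sym _ _) | put (.pos _) | done _ | idle _ => True
  | _ => False

section

variable (enc : Γ → Fin k → Bool) (M : Machine Q Γ)

/-- The gates of the evaluation that set the buffer of a value. -/
def feed : Value Q Γ m → Set (Gate Q Γ m k)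
  | .sym i a => {w | w = load i a ∨ w = keep i a ∨ ∃ d, w = move i a d}
  | .pos i => {w | (w = boot ∧ (i : ℕ) = 0) ∨ ∃ i' a d, moveHead d i' = i ∧ w = move i' a d}
  | .st q => {w | (w = boot ∧ q = M.start) ∨
      ∃ q' a b d, M.trans q' a = some (q, b, d) ∧ w = rule q' a}

/-- The positive inputs of the gates. -/
def posIn : Gate Q Γ m k → Set (Gate Q Γ m k)
  | fetch₁ => {fetch₂, fetchOn}
  | fetch₂ => {fetch₁}
  | write₁ => {write₂, writeOn}
  | write₂ => {write₁}
  | loaded₁ => {loaded₂, write₂}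
  | loaded₂ => {loaded₁}
  | fetchOn => {w | w = wipe ∨ ∃ q, w = idle q}
  | fetchOff => {erase, loaded₂}
  | writeOn => {w | w = fetch₂ ∨ w = live ∨ ∃ f, w = full f}
  | writeOff => {w | w = copy ∨ ∃ f, w = stored f}
  | wipe => ∅
  | erase => {fetch₂, write₂}
  | copy => {write₂}
  | boot => {fetch₂}
  | clock => {fetch₂, loaded₂}
  | live => {boot, clock}
  | input _ _ => {boot}
  | load i a => {w | w = boot ∨ ∃ b, b ≠ a ∧ w = input i b}
  | sense v => {w | w = clock ∨ ∃ b ∈ v.ones enc, w = mem₂ b}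
  | away i => {w | ∃ i', i' ≠ i ∧ w = sense (.pos i')}
  | hit i a => {sense (.sym i a), sense (.pos i)}
  | scan a => {w | ∃ i, w = hit i a}
  | rule q a => {sense (.st q), scan a}
  | act a d => {w | ∃ q b q', M.trans q b = some (q', a, d) ∧ w = rule q b}
  | keep i a => {sense (.sym i a), away i}
  | move i a d => {sense (.pos i), act a d}
  | buf₁ v => {w | w = buf₂ v ∨ w ∈ feed M v}
  | buf₂ v => {buf₁ v}
  | full f => {w | ∃ v, v.field = f ∧ w = buf₂ v}
  | put (.st _) => {copy}
  | put v => {copy, buf₂ v}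
  | done v => {w | w = put v ∨ ∃ b ∈ v.ones enc, w = mem₂ b}
  | stored f => {w | ∃ v, v.field = f ∧ w = done v}
  | mem₁ b => {w | w = mem₂ b ∨ ∃ v, b ∈ Value.ones enc v ∧ w = put v}
  | mem₂ b => {mem₁ b}
  | idle _ => ∅

/-- The negative inputs of the gates. -/
def negIn : Gate Q Γ m k → Set (Gate Q Γ m k)
  | fetch₁ => {fetchOff}
  | write₁ => {writeOff}
  | fetchOn => {w | w.IsStale}
  | fetchOff => {w | (∃ b, w = mem₁ b) ∨ ∃ b, w = mem₂ b}
  | writeOff => {writeOn, erase, fetchOff}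
  | wipe => {fetch₂, write₂}
  | erase => {w | w = fetchOn ∨ w = wipe ∨ w.IsData}
  | copy => {fetch₂}
  | boot => {loaded₂, write₂}
  | clock | live | input _ _ | load _ _ | away _ | hit _ _ | scan _ | rule _ _ | act _ _ | keep _ _
  | move _ _ _ => {write₂}
  | sense v => {w | w = write₂ ∨ ∃ b ∈ v.zeros enc, w = mem₂ b}
  | buf₁ _ | buf₂ _ => {wipe}
  | put (.st q) => {idle q}
  | mem₁ _ | mem₂ _ => {erase}
  | idle q => {buf₂ (.st q)}
  | _ => ∅

end

end Gate

open Gate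

/-- The circuit that simulates the machine `M`. -/
def machineCircuit (enc : Γ → Fin k → Bool) (M : Machine Q Γ) : Circuit (Gate Q Γ m k) where
  conj := AllOf
  pos := posIn enc M
  neg := negIn enc
  pos_irrefl v := by
    cases v
    case put v => cases v <;> simp [posIn]
    case buf₁ v => cases v <;> simp [posIn, feed]
    all_goals simp [posIn]
  neg_irrefl v := by
    cases v
    case put v => cases v <;> simp [negIn]
    all_goals simp [negIn, IsData, IsStale]

/-- The values that the gates compute when the tape content is `x`. -/
def next (enc : Γ → Fin k → Bool) (M : Machine Q Γ) (x : Fin m → Γ) (t : Gate Q Γ m k → Prop) :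
    Gate Q Γ m k → Prop
  | fetch₁ => (t fetch₂ ∨ t fetchOn) ∧ ¬ t fetchOff
  | fetch₂ => t fetch₁
  | write₁ => (t write₂ ∨ t writeOn) ∧ ¬ t writeOff
  | write₂ => t write₁
  | loaded₁ => t loaded₂ ∨ t write₂
  | loaded₂ => t loaded₁
  | fetchOn => (t wipe ∧ ∀ q, t (idle q)) ∧ ∀ w, w.IsStale → ¬ t w
  | fetchOff => (t erase ∧ t loaded₂) ∧ ∀ b, ¬ t (mem₁ b) ∧ ¬ t (mem₂ b)
  | writeOn => t fetch₂ ∧ t live ∧ ∀ f, t (full f)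
  | writeOff => (t copy ∧ ∀ f, t (stored f)) ∧ ¬ t writeOn ∧ ¬ t erase ∧ ¬ t fetchOff
  | wipe => ¬ t fetch₂ ∧ ¬ t write₂
  | erase => (t fetch₂ ∧ t write₂) ∧ ¬ t fetchOn ∧ ¬ t wipe ∧ ∀ w, w.IsData → ¬ t w
  | copy => t write₂ ∧ ¬ t fetch₂
  | boot => t fetch₂ ∧ ¬ t loaded₂ ∧ ¬ t write₂
  | clock => (t fetch₂ ∧ t loaded₂) ∧ ¬ t write₂
  | live => (t boot ∨ t clock) ∧ ¬ t write₂
  | input i a => a ≠ x i ∧ t boot ∧ ¬ t write₂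
  | load i a => (t boot ∧ ∀ b, b ≠ a → t (input i b)) ∧ ¬ t write₂
  | sense v => (t clock ∧ ∀ b ∈ v.ones enc, t (mem₂ b)) ∧ ¬ t write₂ ∧
      ∀ b ∈ v.zeros enc, ¬ t (mem₂ b)
  | away i => (∃ i', i' ≠ i ∧ t (sense (.pos i'))) ∧ ¬ t write₂
  | hit i a => (t (sense (.sym i a)) ∧ t (sense (.pos i))) ∧ ¬ t write₂
  | scan a => (∃ i, t (hit i a)) ∧ ¬ t write₂
  | rule q a => (t (sense (.st q)) ∧ t (scan a)) ∧ ¬ t write₂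
  | act a d => (∃ q b q', M.trans q b = some (q', a, d) ∧ t (rule q b)) ∧ ¬ t write₂
  | keep i a => (t (sense (.sym i a)) ∧ t (away i)) ∧ ¬ t write₂
  | move i a d => (t (sense (.pos i)) ∧ t (act a d)) ∧ ¬ t write₂
  | buf₁ v => (t (buf₂ v) ∨ ∃ w ∈ feed M v, t w) ∧ ¬ t wipe
  | buf₂ v => t (buf₁ v) ∧ ¬ t wipe
  | full f => ∃ v, v.field = f ∧ t (buf₂ v)
  | put (.st q) => t copy ∧ ¬ t (idle q)
  | put v => t copy ∧ t (buf₂ v)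
  | done v => t (put v) ∧ ∀ b ∈ v.ones enc, t (mem₂ b)
  | stored f => ∃ v, v.field = f ∧ t (done v)
  | mem₁ b => (t (mem₂ b) ∨ ∃ v, b ∈ Value.ones enc v ∧ t (put v)) ∧ ¬ t erase
  | mem₂ b => t (mem₁ b) ∧ ¬ t erase
  | idle q => ¬ t (buf₂ (.st q))

section

variable (enc : Γ → Fin k → Bool) (M : Machine Q Γ) (x : Fin m → Γ) (t : Gate Q Γ m k → Prop)

theorem machineCircuit_eval :
    (machineCircuit enc M).eval {v | ∃ i, v = input i (x i)} t = next enc M x t := by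
  funext v
  apply propext
  cases v
  case put v =>
    cases v <;> simp [Circuit.eval, machineCircuit, AllOf, posIn, negIn, next]
  case input i a =>
    have : (∃ i', i = i' ∧ a = x i') ↔ a = x i := by simp
    simp [Circuit.eval, machineCircuit, AllOf, posIn, negIn, next]
  all_goals
    simp only [Circuit.eval, machineCircuit, AllOf, posIn, negIn, next, Set.mem_ofPred_eq,
      Set.mem_insert_iff, Set.mem_singleton_iff, Set.mem_empty_iff_false]
    simp [or_and_right, exists_or, forall_and, or_imp]
    try grind

variable {enc M x t}

/-- The latch `write` blocks the evaluation. -/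
theorem not_next_of_write₂ (h : t write₂) {v : Gate Q Γ m k} (hv : v.IsData) :
    ¬ next enc M x t v := by
  cases v <;> simp_all [next, IsData]

/-- In the absence of `fetch`, the evaluation does not start. -/
theorem not_next_of_data (h : ¬ t fetch₂) (hd : ∀ w : Gate Q Γ m k, w.IsData → ¬ t w)
    {v : Gate Q Γ m k} (hv : v.IsData) : ¬ next enc M x t v := by
  have h1 := hd boot trivial
  have h2 := hd clock trivial
  have h3 : ∀ v, ¬ t (sense v) := fun v => hd (sense v) trivial
  have h4 : ∀ i a, ¬ t (hit i a) := fun i a => hd (hit i a) trivial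
  have h5 : ∀ q a, ¬ t (rule q a) := fun i a => hd (rule i a) trivial
  cases v <;> simp_all [next, IsData]

end

/-! ### Phases of the machine circuit -/

section Modes

variable {enc : Γ → Fin k → Bool} {M : Machine Q Γ} {x : Fin m → Γ}

theorem next_of_rise {tr : Gate Q Γ m k → Trend} {t d t' : Gate Q Γ m k → Prop} {v : Gate Q Γ m k}
    (h : Between tr t d t') (hk : (∀ w ∈ posIn enc M v, tr w ≠ .fall) ∧
      ∀ w ∈ negIn enc v, tr w ≠ .rise) (hv : next enc M x t v) : next enc M x t' v := by
  rw [← machineCircuit_eval] at hv ⊢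
  exact Circuit.eval_mono h hk.1 hk.2 hv

theorem next_of_fall {tr : Gate Q Γ m k → Trend} {t d t' : Gate Q Γ m k → Prop} {v : Gate Q Γ m k}
    (h : Between tr t d t') (hk : (∀ w ∈ posIn enc M v, tr w ≠ .rise) ∧
      ∀ w ∈ negIn enc v, tr w ≠ .fall) (hv : next enc M x t' v) : next enc M x t v := by
  rw [← machineCircuit_eval] at hv ⊢
  exact Circuit.eval_anti h hk.1 hk.2 hv

/-- A criterion for phases of the machine circuit: a gate that may rise has no falling positive and
no rising negative inputs; a gate that may fall has no rising positive and no falling negative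
inputs, unless it is disabled throughout the phase. -/
theorem Phase.of_inputs {tr : Gate Q Γ m k → Trend} {l : Gate Q Γ m k}
    {s d : Gate Q Γ m k → Prop} (exit : tr l = .hold)
    (baseRise : ∀ {v}, tr v = .rise → s v → next enc M x s v ∧ d v)
    (baseFall : ∀ {v}, tr v = .fall → (next enc M x s v → s v) ∧ (d v → s v))
    (topRise : ∀ {t v}, Between tr s d t → tr v = .rise → next enc M x t v → d v)
    (topFall : ∀ {t v}, Between tr s d t → tr v = .fall → d v → next enc M x t v)
    (inputsRise : ∀ v, tr v = .rise →
      (∀ w ∈ posIn enc M v, tr w ≠ .fall) ∧ ∀ w ∈ negIn enc v, tr w ≠ .rise)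
    (inputsFall : ∀ v, tr v = .fall → (∀ t, Between tr s d t → ¬ next enc M x t v) ∨
      ((∀ w ∈ posIn enc M v, tr w ≠ .rise) ∧ ∀ w ∈ negIn enc v, tr w ≠ .fall))
    (holds : ∀ {t v}, PhaseInv (next enc M x) tr s d t → tr v = .hold → v ≠ l →
      (next enc M x t v ↔ s v)) :
    Phase (next enc M x) tr l s d where
  exit := exit
  baseRise := baseRise
  baseFall := baseFall
  topRise := topRise
  topFall := topFall
  monoRise _ _ h hv := next_of_rise h (inputsRise _ hv)
  monoFall _ h' h hv hn := by
    rcases inputsFall _ hv with hd | hk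
    · exact absurd hn (hd _ h')
    · exact next_of_fall h hk hn
  holds := holds

/-! ### The mode "wipe" -/

/-- The states in which the mode "wipe" may start, with the stored bits `β`; `y` tells whether the
input has been loaded. -/
structure WipeStart (enc : Γ → Fin k → Bool) (M : Machine Q Γ) (x : Fin m → Γ)
    (β : Bit Q m k → Prop) (y : Prop) (s : Gate Q Γ m k → Prop) : Prop where
  fetch₁ : ¬ s fetch₁
  fetch₂ : ¬ s fetch₂
  write₁ : ¬ s write₁
  write₂ : ¬ s write₂
  loaded₁ : s loaded₁ ↔ y
  loaded₂ : s loaded₂ ↔ y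
  fetchOn : ¬ s fetchOn
  fetchOff : ¬ s fetchOff
  writeOn : ¬ s writeOn
  wipe : ¬ s wipe
  erase : ¬ s erase
  data : ∀ v, v.IsData → ¬ s v
  mem₁ : ∀ b, s (mem₁ b) ↔ β b
  mem₂ : ∀ b, s (mem₂ b) ↔ β b
  idle : ∀ q, s (idle q) → ¬ s (buf₂ (.st q))
  stale : ∀ v, v.IsStale → next enc M x s v → s v
  put : ∀ v, s (put v) → ∀ b ∈ v.ones enc, β b

/-- The states in which the mode "evaluate" starts. -/
structure EvalStart (β : Bit Q m k → Prop) (y : Prop) (s : Gate Q Γ m k → Prop) : Prop where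
  fetch₁ : s fetch₁
  fetch₂ : s fetch₂
  write₁ : ¬ s write₁
  write₂ : ¬ s write₂
  loaded₁ : s loaded₁ ↔ y
  loaded₂ : s loaded₂ ↔ y
  fetchOn : s fetchOn
  fetchOff : ¬ s fetchOff
  writeOn : ¬ s writeOn
  wipe : s wipe
  erase : ¬ s erase
  data : ∀ v, v.IsData → ¬ s v
  mem₁ : ∀ b, s (mem₁ b) ↔ β b
  mem₂ : ∀ b, s (mem₂ b) ↔ β b
  idle : ∀ q, s (idle q)
  stale : ∀ v, v.IsStale → ¬ s v

/-- In the mode "wipe", the stale gates fall, while the gates that set the latch `fetch` rise. -/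
def wipeTrend : Gate Q Γ m k → Trend
  | wipe | fetchOn | fetch₁ | idle _ => .rise
  | buf₁ _ | buf₂ _ | full _ | copy | put _ | done _ | stored _ | writeOff => .fall
  | _ => .hold

theorem wipeTrend_data {v : Gate Q Γ m k} (hv : v.IsData) : wipeTrend v = .hold := by
  cases v <;> first | rfl | exact hv.elim

variable {β : Bit Q m k → Prop} {y : Prop} {s : Gate Q Γ m k → Prop}

/-- The mode "wipe" is a phase, which ends when `fetch₂` is set. -/
theorem WipeStart.phase (h : WipeStart enc M x β y s) :
    Phase (next enc M x) wipeTrend .fetch₂ s (fun v => wipeTrend v = .rise) := by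
  refine Phase.of_inputs rfl ?_ ?_ (fun _ h _ => h) ?_ ?_ ?_ ?_
  · intro v hv hs
    refine ⟨?_, hv⟩
    cases v <;> try (cases hv; done)
    · exact absurd hs h.fetch₁
    · exact absurd hs h.fetchOn
    · exact absurd hs h.wipe
    · exact h.idle _ hs
  · intro v hv
    refine ⟨h.stale v ?_, fun h' => by simp [hv] at h'⟩
    cases v <;> first | (cases hv; done) | trivial
  · intro t v _ hv h'
    simp [hv] at h'
  · intro v hv
    cases v <;> first | (cases hv; done) | simp [posIn, negIn, wipeTrend]
    intro w hw
    cases w <;> simp_all [IsStale]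
  · intro v hv
    right
    cases v <;> try (cases hv; done)
    case put v => cases v <;> simp [posIn, negIn, wipeTrend]
    case buf₁ v => cases v <;> simp [posIn, negIn, wipeTrend, feed] <;> grind
    all_goals
      simp [posIn, negIn, wipeTrend]
      try (rintro _ _ _ rfl; simp)
  · intro t v ht hv hvl
    have f2 : ¬ t .fetch₂ := fun h' => h.fetch₂ ((ht.hold rfl).1 h')
    have w2 : ¬ t .write₂ := fun h' => h.write₂ ((ht.hold rfl).1 h')
    have hdata : ∀ w, w.IsData → ¬ t w := fun w hw h' =>
      h.data w hw ((ht.hold (wipeTrend_data hw)).1 h')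
    by_cases hvd : v.IsData
    · exact iff_of_false (not_next_of_data f2 hdata hvd) (h.data v hvd)
    have e1 : ¬ t .erase := fun h' => h.erase ((ht.hold rfl).1 h')
    have hw1 : ¬ t .write₁ := fun h' => h.write₁ ((ht.hold rfl).1 h')
    have hwo : ¬ t .writeOn := fun h' => h.writeOn ((ht.hold rfl).1 h')
    have l1 := ht.hold (v := .loaded₁) rfl
    have l2 := ht.hold (v := .loaded₂) rfl
    cases v <;> first | (cases hv; done) | exact absurd trivial hvd | skip
    · exact absurd rfl hvl
    · simp [next, w2, hwo, h.write₁]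
    · simp [next, hw1, h.write₂]
    · simp [next, l2, w2, h.loaded₁, h.loaded₂]
    · simp [next, l1, h.loaded₁, h.loaded₂]
    · simp [next, e1, h.fetchOff]
    · simp [next, f2, h.writeOn]
    · simp [next, f2, h.erase]
    · rename_i b
      simp only [next, ht.hold (v := .mem₂ b) rfl, h.mem₂, h.mem₁, e1, not_false_eq_true, and_true,
        or_iff_left_iff_imp]
      rintro ⟨v, hb, hv⟩
      exact h.put v (ht.fallHigh rfl hv) b hb
    · rename_i b
      simp [next, ht.hold (v := .mem₁ b) rfl, h.mem₂, h.mem₁, e1]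

/-- The gate `v` does not rise in the steps from round `n₀` to round `n`. -/
def StaysLow (t : ℕ → Gate Q Γ m k → Prop) (v : Gate Q Γ m k) (n₀ n : ℕ) : Prop :=
  ∀ j, n₀ ≤ j → j < n → t (j + 1) v → t j v

/-- The mode "wipe" ends in the mode "evaluate", without a tick of the clock. -/
theorem WipeStart.run [Finite (Gate Q Γ m k)] (h : WipeStart enc M x β y s)
    {t : ℕ → Gate Q Γ m k → Prop}
    (hr : AsyncRun (next enc M x) t) {n₀ : ℕ} (hs : t n₀ = s) :
    ∃ n, n₀ < n ∧ StaysLow t clock n₀ n ∧ EvalStart β y (t n) := by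
  obtain ⟨n, hn, hinv, hmono, hend⟩ := h.phase.run hr hs
  have ht := hinv n hn le_rfl
  have f2 : ¬ t n .fetch₂ := fun h' => h.fetch₂ ((ht.hold rfl).1 h')
  have w1 : ¬ t n .write₁ := fun h' => h.write₁ ((ht.hold rfl).1 h')
  have w2 : ¬ t n .write₂ := fun h' => h.write₂ ((ht.hold rfl).1 h')
  have e1 : ¬ t n .erase := fun h' => h.erase ((ht.hold rfl).1 h')
  have fo : ¬ t n .fetchOff := fun h' => h.fetchOff ((ht.hold rfl).1 h')
  have hwo : ¬ t n .writeOn := fun h' => h.writeOn ((ht.hold rfl).1 h')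
  have hdata : ∀ w, w.IsData → ¬ t n w := fun w hw h' =>
      h.data w hw ((ht.hold (wipeTrend_data hw)).1 h')
  rcases hend with hq | hf
  · -- A quiet state of this phase would have `fetch₁` on, and thus `fetch₂` excited.
    exfalso
    have q1 : t n .wipe := (hq .wipe).1 ⟨f2, w2⟩
    have q2 : ∀ v, ¬ t n (.buf₁ v) := fun v hv => ((hq _).2 hv).2 q1
    have q3 : ∀ v, ¬ t n (.buf₂ v) := fun v hv => ((hq _).2 hv).2 q1
    have q4 : ∀ f, ¬ t n (.full f) := fun f hf => by
      obtain ⟨v, -, hv⟩ := (hq _).2 hf; exact q3 v hv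
    have q5 : ∀ q, t n (.idle q) := fun q => (hq (.idle q)).1 (q3 _)
    have q6 : ¬ t n .copy := fun h' => w2 ((hq .copy).2 h').1
    have q7 : ∀ v, ¬ t n (.put v) := fun v hv => by
      have := (hq _).2 hv
      cases v <;> exact q6 this.1
    have q8 : ∀ v, ¬ t n (.done v) := fun v hv => q7 _ ((hq _).2 hv).1
    have q9 : ∀ f, ¬ t n (.stored f) := fun f hf => by
      obtain ⟨v, -, hv⟩ := (hq _).2 hf; exact q8 v hv
    have q10 : ¬ t n .writeOff := fun h' => q6 ((hq .writeOff).2 h').1.1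
    have q11 : t n .fetchOn := (hq .fetchOn).1 ⟨⟨q1, q5⟩, fun w hw => by
      cases w <;> first | exact hw.elim | solve_by_elim⟩
    exact f2 ((hq .fetch₂).1 ((hq .fetch₁).1 ⟨.inr q11, fo⟩))
  · have h1 : t n .fetch₁ := by
      have := hf.excited
      simp only [next] at this
      tauto
    have h2 : t n .fetchOn := (ht.rise rfl h1).1.resolve_left f2
    obtain ⟨⟨h3, h4⟩, h5⟩ := ht.rise (v := .fetchOn) rfl h2
    have ho : ∀ v, v ≠ .fetch₂ → (t (n + 1) v ↔ t n v) := hf.other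
    refine ⟨n + 1, by omega, fun j hj hj' => ?_, ?_⟩
    · rcases (Nat.lt_succ_iff.1 hj').eq_or_lt with rfl | hj'
      · exact (ho _ (by simp)).1
      · exact (hmono j clock hj hj').2 (by simp [wipeTrend])
    · constructor
      case fetch₂ => exact hf.new.2 h1
      case data =>
        intro v hv
        rw [ho v (by rintro rfl; exact hv)]; exact hdata v hv
      case stale =>
        intro v hv
        rw [ho v (by rintro rfl; exact hv)]; exact h5 v hv
      all_goals
        intros
        rw [ho _ (by simp)]
        first | assumption | skip
      · rw [ht.hold rfl, h.loaded₁]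
      · rw [ht.hold rfl, h.loaded₂]
      · rw [ht.hold rfl, h.mem₁]
      · rw [ht.hold rfl, h.mem₂]
      · exact h4 _

/-! ### The mode "evaluate" -/

/-- The gates of the evaluation end up with the values `D`. -/
structure EvalTarget (enc : Γ → Fin k → Bool) (M : Machine Q Γ) (x : Fin m → Γ)
    (β : Bit Q m k → Prop) (y : Prop) (D : Gate Q Γ m k → Prop) : Prop where
  top : ∀ {t : Gate Q Γ m k → Prop}, (t loaded₂ ↔ y) → (∀ b, t (mem₂ b) ↔ β b) →
    (∀ w, w.IsData → t w → D w) → ∀ v, v.IsData → next enc M x t v → D v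
  quiet : ∀ {t : Gate Q Γ m k → Prop}, Quiet (next enc M x) t → t fetch₂ → ¬ t write₂ →
    (t loaded₂ ↔ y) → (∀ b, t (mem₂ b) ↔ β b) → ∀ v, v.IsData → D v → t v

/-- The values that are put into the buffer. -/
def fed (M : Machine Q Γ) (D : Gate Q Γ m k → Prop) (v : Value Q Γ m) : Prop :=
  ∃ w ∈ feed M v, D w

/-- In the mode "evaluate", the gates of the evaluation and the buffer rise, and then those that set
the latch `write`. -/
def evalTrend : Gate Q Γ m k → Trend
  | boot | clock | live | input _ _ | load _ _ | sense _ | away _ | hit _ _ | scan _ | rule _ _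
  | act _ _ | keep _ _ | move _ _ _ | buf₁ _ | buf₂ _ | full _ | writeOn | write₁ => .rise
  | wipe | fetchOn | idle _ => .fall
  | _ => .hold

/-- The state that the mode "evaluate" cannot exceed. -/
def evalGoal (M : Machine Q Γ) (D : Gate Q Γ m k → Prop) : Gate Q Γ m k → Prop
  | buf₁ v | buf₂ v => fed M D v
  | full f => ∃ v, v.field = f ∧ fed M D v
  | idle q => ¬ fed M D (.st q)
  | writeOn | write₁ => True
  | wipe | fetchOn => False
  | v => D v

/-- The states in which the mode "erase" may start; the buffer holds the values `σ`. -/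
structure EraseStart (M : Machine Q Γ) (β : Bit Q m k → Prop) (σ : Value Q Γ m → Prop) (y : Prop)
    (s : Gate Q Γ m k → Prop) : Prop where
  fetch₁ : s fetch₁
  fetch₂ : s fetch₂
  write₁ : s write₁
  write₂ : s write₂
  loaded₁ : s loaded₁ ↔ y
  loaded₂ : s loaded₂ ↔ y
  fetchOff : ¬ s fetchOff
  writeOn : s writeOn
  writeOff : ¬ s writeOff
  wipe : ¬ s wipe
  erase : ¬ s erase
  copy : ¬ s copy
  buf₁ : ∀ v, s (buf₁ v) ↔ σ v
  buf₂ : ∀ v, s (buf₂ v) ↔ σ v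
  full : ∀ f, s (full f)
  feed : ∀ v, ∀ w ∈ feed M v, s w → σ v
  put : ∀ v, ¬ s (put v)
  done : ∀ v, ¬ s (done v)
  stored : ∀ f, ¬ s (stored f)
  mem₁ : ∀ b, s (mem₁ b) ↔ β b
  mem₂ : ∀ b, s (mem₂ b) ↔ β b
  idle : ∀ q, ¬ σ (.st q) → s (idle q)

theorem evalTrend_data {v : Gate Q Γ m k} (hv : v.IsData) : evalTrend v = .rise := by
  cases v <;> first | rfl | exact hv.elim

theorem evalGoal_data {D : Gate Q Γ m k → Prop} {v : Gate Q Γ m k} (hv : v.IsData) :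
    evalGoal M D v = D v := by
  cases v <;> first | rfl | exact hv.elim

theorem isData_of_mem_feed {v : Value Q Γ m} {w : Gate Q Γ m k} (hw : w ∈ feed M v) :
    w.IsData := by
  cases v <;> simp only [feed, Set.mem_ofPred_eq] at hw
  · rcases hw with rfl | rfl | ⟨d, rfl⟩ <;> trivial
  · rcases hw with ⟨rfl, -⟩ | ⟨i, a, d, -, rfl⟩ <;> trivial
  · rcases hw with ⟨rfl, -⟩ | ⟨q, a, b, d, -, rfl⟩ <;> trivial

variable {D : Gate Q Γ m k → Prop}

/-- The mode "evaluate" is a phase, which ends when `write₂` is set. -/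
theorem EvalStart.phase (h : EvalStart β y s) (hD : EvalTarget enc M x β y D) :
    Phase (next enc M x) evalTrend .write₂ s (evalGoal M D) := by
  refine Phase.of_inputs rfl ?_ ?_ ?_ ?_ ?_ ?_ ?_
  · intro v hv hs
    exfalso
    by_cases hvd : v.IsData
    · exact h.data v hvd hs
    cases v <;> first | (cases hv; done) | exact absurd trivial hvd | skip
    · exact h.write₁ hs
    · exact h.writeOn hs
    all_goals exact h.stale _ (by trivial) hs
  · intro v hv
    cases v <;> try (cases hv; done)
    · exact ⟨fun _ => h.fetchOn, fun _ => h.fetchOn⟩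
    · exact ⟨fun _ => h.wipe, fun _ => h.wipe⟩
    · exact ⟨fun _ => h.idle _, fun _ => h.idle _⟩
  · intro t v ht hv hn
    by_cases hvd : v.IsData
    · rw [evalGoal_data hvd]
      refine hD.top ((ht.hold rfl).trans h.loaded₂) (fun b => (ht.hold rfl).trans (h.mem₂ b))
        (fun w hw htw => ?_) v hvd hn
      have := ht.riseHigh (evalTrend_data hw) htw
      rwa [evalGoal_data hw] at this
    cases v <;> first | (cases hv; done) | exact absurd trivial hvd | skip
    · trivial
    · trivial
    · rcases hn.1 with h1 | ⟨w, hw, htw⟩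
      · exact ht.riseHigh (v := .buf₂ _) rfl h1
      · have hwd := isData_of_mem_feed hw
        have := ht.riseHigh (evalTrend_data hwd) htw
        rw [evalGoal_data hwd] at this
        exact ⟨w, hw, this⟩
    · exact ht.riseHigh (v := .buf₁ _) rfl hn.1
    · obtain ⟨v, hv, htv⟩ := hn
      exact ⟨v, hv, ht.riseHigh (v := .buf₂ _) rfl htv⟩
  · intro t v ht hv hd
    cases v <;> try (cases hv; done)
    · exact hd.elim
    · exact hd.elim
    · exact fun hb => hd (ht.riseHigh (v := .buf₂ _) rfl hb)
  · intro v hv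
    cases v <;> try (cases hv; done)
    case buf₁ v => cases v <;> simp [posIn, negIn, evalTrend, feed] <;> grind
    all_goals
      simp [posIn, negIn, evalTrend]
      try first
      | (rintro _ _ _ rfl; simp)
      | (rintro _ _ _ _ _ rfl; simp)
      | (constructor <;> rintro _ _ _ rfl <;> simp)
  · intro v hv
    cases v <;> try (cases hv; done)
    · right
      simp [posIn, negIn, evalTrend]
      intro w hw
      cases w <;> simp_all [IsStale]
    · left
      intro t ht hn
      exact hn.1 ((ht.hold rfl).2 h.fetch₂)
    · right
      simp [posIn, negIn, evalTrend]
  · intro t v ht hv hvl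
    have f2 : t .fetch₂ := (ht.hold rfl).2 h.fetch₂
    have f1 : t .fetch₁ := (ht.hold rfl).2 h.fetch₁
    have w2 : ¬ t .write₂ := fun h' => h.write₂ ((ht.hold rfl).1 h')
    have fo : ¬ t .fetchOff := fun h' => h.fetchOff ((ht.hold rfl).1 h')
    have e1 : ¬ t .erase := fun h' => h.erase ((ht.hold rfl).1 h')
    have c1 : ¬ t .copy := fun h' => h.stale .copy trivial ((ht.hold rfl).1 h')
    have pv : ∀ v, ¬ t (.put v) := fun v h' => h.stale _ (by trivial) ((ht.hold rfl).1 h')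
    have dv : ∀ v, ¬ t (.done v) := fun v h' => h.stale _ (by trivial) ((ht.hold rfl).1 h')
    have l1 := ht.hold (v := .loaded₁) rfl
    have l2 := ht.hold (v := .loaded₂) rfl
    cases v <;> first | (cases hv; done) | skip
    case put v =>
      refine iff_of_false (fun hn => ?_) (h.stale _ (by trivial))
      cases v <;> exact c1 hn.1
    all_goals
      simp [next, *, h.fetch₁, h.fetch₂, h.loaded₁, h.loaded₂, h.fetchOff, h.erase] at *
    · exact h.stale _ (by trivial)
    · exact h.stale _ (by trivial)
    · exact h.stale _ (by trivial)
    · exact h.stale _ (by trivial)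
    · rw [ht.hold rfl, h.mem₁, h.mem₂]
    · rw [ht.hold rfl, h.mem₁, h.mem₂]

variable {σ : Value Q Γ m → Prop}

/-- The mode "evaluate" ends in the mode "erase", provided that each register gets a new value;
otherwise, the circuit becomes quiet. The stored bits do not change, and `clock` does not fall. -/
theorem EvalStart.run [Finite (Gate Q Γ m k)] (h : EvalStart β y s)
    (hD : EvalTarget enc M x β y D) (hlive : D live) {t : ℕ → Gate Q Γ m k → Prop}
    (hr : AsyncRun (next enc M x) t) {n₀ : ℕ} (hs : t n₀ = s) :
    ∃ n, n₀ ≤ n ∧ (∀ j, n₀ ≤ j → j ≤ n → ∀ b, (t j (.mem₁ b) ↔ β b) ∧ (t j (.mem₂ b) ↔ β b)) ∧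
      (∀ j, n₀ ≤ j → j < n → t j clock → t (j + 1) clock) ∧
      (∀ j, n₀ ≤ j → j ≤ n → t j clock → D clock) ∧
      ((Quiet (next enc M x) (t n) ∧ (¬ ∀ f, ∃ v, v.field = f ∧ fed M D v) ∧
          (D clock → t n clock)) ∨
        ((∀ f, ∃ v, v.field = f ∧ fed M D v) ∧ (¬ D boot → t n clock) ∧
          (t (n + 1) clock ↔ t n clock) ∧
          ((∀ v w, fed M D v → fed M D w → v.field = w.field → v = w) →
            EraseStart M β (fed M D) y (t (n + 1))))) := by
  obtain ⟨n, hn, hinv, hmono, hend⟩ := (h.phase hD).run hr hs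
  have ht := hinv n hn le_rfl
  have f2 : t n .fetch₂ := (ht.hold rfl).2 h.fetch₂
  have w2 : ¬ t n .write₂ := fun h' => h.write₂ ((ht.hold rfl).1 h')
  have wo : ¬ t n .writeOff := fun h' => h.stale .writeOff trivial ((ht.hold rfl).1 h')
  have hl2 : t n .loaded₂ ↔ y := (ht.hold rfl).trans h.loaded₂
  have hm2 : ∀ b, t n (.mem₂ b) ↔ β b := fun b => (ht.hold rfl).trans (h.mem₂ b)
  refine ⟨n, hn, fun j hj hj' b => ⟨((hinv j hj hj').hold rfl).trans (h.mem₁ b),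
    ((hinv j hj hj').hold rfl).trans (h.mem₂ b)⟩, fun j hj hj' => (hmono j clock hj hj').1 rfl,
    fun j hj hj' => (hinv j hj hj').riseHigh (v := .clock) rfl, ?_⟩
  rcases hend with hq | hf
  · left
    have hdata := hD.quiet hq f2 w2 hl2 hm2
    refine ⟨hq, fun hfull => ?_, hdata clock trivial⟩
    -- If all registers got a value, then `writeOn` would be on, and thus `write₁` excited.
    have q1 : ¬ t n .wipe := fun h' => ((hq .wipe).2 h').1 f2
    have q2 : ∀ f, t n (.full f) := fun f => by
      obtain ⟨v, hv, w, hw, hDw⟩ := hfull f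
      have hb : t n (.buf₁ v) :=
        (hq (.buf₁ v)).1 ⟨.inr ⟨w, hw, hdata w (isData_of_mem_feed hw) hDw⟩, q1⟩
      exact (hq (.full f)).1 ⟨v, hv, (hq (.buf₂ v)).1 ⟨hb, q1⟩⟩
    have q3 : t n .writeOn := (hq .writeOn).1 ⟨f2, hdata live trivial hlive, q2⟩
    exact w2 ((hq .write₂).1 ((hq .write₁).1 ⟨.inr q3, wo⟩))
  · right
    have w1 : t n .write₁ := by
      have := hf.excited
      simp only [next] at this
      tauto
    have won : t n .writeOn := (ht.rise (v := .write₁) rfl w1).1.resolve_left w2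
    obtain ⟨-, hl, hfull⟩ := ht.rise (v := .writeOn) rfl won
    have hbuf : ∀ v, t n (.buf₂ v) → fed M D v := fun v => ht.riseHigh (v := .buf₂ v) rfl
    have hex : ∀ f, ∃ v, v.field = f ∧ t n (.buf₂ v) := fun f =>
      ht.rise (v := .full f) rfl (hfull f)
    have ho : ∀ v, v ≠ .write₂ → (t (n + 1) v ↔ t n v) := hf.other
    refine ⟨fun f => ?_, fun hb => ?_, ho _ (by simp), fun huniq => ?_⟩
    · obtain ⟨v, hv, hv'⟩ := hex f
      exact ⟨v, hv, hbuf v hv'⟩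
    · exact (ht.rise (v := .live) rfl hl).1.resolve_left fun hb' =>
        hb (ht.riseHigh (v := .boot) rfl hb')
    · have hbuf2 : ∀ v, t n (.buf₂ v) ↔ fed M D v := fun v => ⟨hbuf v, fun hv => by
        obtain ⟨w, hw, hw'⟩ := hex v.field
        rwa [huniq v w hv (hbuf w hw') hw.symm]⟩
      have hjust : ∀ v, t n (.buf₂ v) → t n (.buf₁ v) ∧ ¬ t n .wipe := fun v hv =>
        ht.rise (v := .buf₂ v) rfl hv
      have hbuf1 : ∀ v, t n (.buf₁ v) ↔ fed M D v := fun v =>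
        ⟨ht.riseHigh (v := .buf₁ v) rfl, fun hv => (hjust v ((hbuf2 v).2 hv)).1⟩
      have hfed : ∀ v, ∀ w ∈ feed M v, t n w → fed M D v := fun v w hw htw => by
        have hwd := isData_of_mem_feed hw
        have := ht.riseHigh (evalTrend_data hwd) htw
        rw [evalGoal_data hwd] at this
        exact ⟨w, hw, this⟩
      constructor
      case write₂ => exact hf.new.2 w1
      case feed =>
        intro v w hw
        rw [ho w (by rintro rfl; exact isData_of_mem_feed hw)]
        exact hfed v w hw
      all_goals
        intros
        rw [ho _ (by simp)]
        first | assumption | skip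
      · exact (ht.hold rfl).2 h.fetch₁
      · exact (ht.hold rfl).trans h.loaded₁
      · exact fun h' => h.fetchOff ((ht.hold rfl).1 h')
      · obtain ⟨v, -, hv⟩ := hex .head
        exact (hjust v hv).2
      · exact fun h' => h.erase ((ht.hold rfl).1 h')
      · exact fun h' => h.stale .copy trivial ((ht.hold rfl).1 h')
      · exact hbuf1 _
      · exact hbuf2 _
      · exact hfull _
      · exact fun h' => h.stale _ (by trivial) ((ht.hold rfl).1 h')
      · exact fun h' => h.stale _ (by trivial) ((ht.hold rfl).1 h')
      · exact fun h' => h.stale _ (by trivial) ((ht.hold rfl).1 h')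
      · exact (ht.hold rfl).trans (h.mem₁ _)
      · exact hm2 _
      · rename_i q hq
        exact ht.fall (v := .idle q) rfl fun hb => hq (hbuf _ hb)

/-! ### The mode "erase" -/

/-- In the mode "erase", the gates of the evaluation and the stored bits fall, while `loaded` is set
for good. The gates `erase` and `fetchOff`, which wait for this, rise, so that `fetch₁` falls. -/
def eraseTrend : Gate Q Γ m k → Trend
  | boot | clock | live | input _ _ | load _ _ | sense _ | away _ | hit _ _ | scan _ | rule _ _
  | act _ _ | keep _ _ | move _ _ _ | mem₁ _ | mem₂ _ | fetchOn | idle _ | fetch₁ | writeOn => .fall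
  | loaded₁ | loaded₂ | erase | fetchOff => .rise
  | _ => .hold

/-- The states in which the mode "copy" may start; the buffer holds the values `σ`. -/
structure CopyStart (σ : Value Q Γ m → Prop) (s : Gate Q Γ m k → Prop) : Prop where
  fetch₁ : ¬ s fetch₁
  fetch₂ : ¬ s fetch₂
  write₁ : s write₁
  write₂ : s write₂
  loaded₁ : s loaded₁
  loaded₂ : s loaded₂
  fetchOn : ¬ s fetchOn
  fetchOff : s fetchOff
  writeOff : ¬ s writeOff
  wipe : ¬ s wipe
  erase : s erase
  copy : ¬ s copy
  data : ∀ v, v.IsData → ¬ s v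
  buf₁ : ∀ v, s (buf₁ v) ↔ σ v
  buf₂ : ∀ v, s (buf₂ v) ↔ σ v
  full : ∀ f, s (full f)
  put : ∀ v, ¬ s (put v)
  done : ∀ v, ¬ s (done v)
  stored : ∀ f, ¬ s (stored f)
  mem₁ : ∀ b, ¬ s (mem₁ b)
  mem₂ : ∀ b, ¬ s (mem₂ b)
  idle : ∀ q, ¬ σ (.st q) → s (idle q)

theorem eraseTrend_data {v : Gate Q Γ m k} (hv : v.IsData) : eraseTrend v = .fall := by
  cases v <;> first | rfl | exact hv.elim

/-- The mode "erase" is a phase, which ends when `fetch₂` is reset. -/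
theorem EraseStart.phase (h : EraseStart M β σ y s) (hσ : ∀ f, ∃ v, v.field = f ∧ σ v) :
    Phase (next enc M x) eraseTrend .fetch₂ s (fun v => eraseTrend v = .rise) := by
  refine Phase.of_inputs rfl ?_ ?_ (fun _ h _ => h) ?_ ?_ ?_ ?_
  · intro v hv hs
    refine ⟨?_, hv⟩
    cases v <;> try (cases hv; done)
    · exact .inr h.write₂
    · exact h.loaded₁.2 (h.loaded₂.1 hs)
    · exact absurd hs h.fetchOff
    · exact absurd hs h.erase
  · intro v hv
    refine ⟨fun hn => ?_, fun h' => by simp [hv] at h'⟩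
    by_cases hvd : v.IsData
    · exact absurd hn (not_next_of_write₂ h.write₂ hvd)
    cases v <;> first | (cases hv; done) | exact absurd trivial hvd | skip
    · exact h.fetch₁
    · exact absurd hn.1.1 h.wipe
    · exact h.writeOn
    · rename_i b
      rcases hn.1 with h1 | ⟨v, -, hv⟩
      · exact (h.mem₁ b).2 ((h.mem₂ b).1 h1)
      · exact absurd hv (h.put v)
    · rename_i b
      exact (h.mem₂ b).2 ((h.mem₁ b).1 hn.1)
    · rename_i q
      exact h.idle q fun hq => hn ((h.buf₂ _).2 hq)
  · intro t v _ hv h'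
    simp [hv] at h'
  · intro v hv
    cases v <;> try (cases hv; done)
    case erase =>
      refine ⟨by simp [posIn, eraseTrend], ?_⟩
      rintro w (rfl | rfl | hw)
      · simp [eraseTrend]
      · simp [eraseTrend]
      · simp [eraseTrend_data hw]
    case fetchOff =>
      refine ⟨by simp [posIn, eraseTrend], ?_⟩
      rintro w (⟨b, rfl⟩ | ⟨b, rfl⟩) <;> simp [eraseTrend]
    all_goals simp [posIn, negIn, eraseTrend]
  · intro v hv
    by_cases hvd : v.IsData
    · exact .inl fun t ht => not_next_of_write₂ ((ht.hold (v := .write₂) rfl).2 h.write₂) hvd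
    cases v <;> first | (cases hv; done) | exact absurd trivial hvd | skip
    case fetchOn =>
      left
      intro t ht hn
      exact h.wipe ((ht.hold rfl).1 hn.1.1)
    all_goals
      right
      simp [posIn, negIn, eraseTrend]
    · rintro _ _ _ rfl; simp
  · intro t v ht hv hvl
    have f2 : t .fetch₂ := (ht.hold rfl).2 h.fetch₂
    have w1 : t .write₁ := (ht.hold rfl).2 h.write₁
    have w2 : t .write₂ := (ht.hold rfl).2 h.write₂
    have wo : ¬ t .writeOff := fun h' => h.writeOff ((ht.hold rfl).1 h')
    have c1 : ¬ t .copy := fun h' => h.copy ((ht.hold rfl).1 h')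
    have wi : ¬ t .wipe := fun h' => h.wipe ((ht.hold rfl).1 h')
    have b1 : ∀ v, t (.buf₁ v) ↔ σ v := fun v => (ht.hold rfl).trans (h.buf₁ v)
    have b2 : ∀ v, t (.buf₂ v) ↔ σ v := fun v => (ht.hold rfl).trans (h.buf₂ v)
    have pv : ∀ v, ¬ t (.put v) := fun v h' => h.put _ ((ht.hold rfl).1 h')
    have dv : ∀ v, ¬ t (.done v) := fun v h' => h.done _ ((ht.hold rfl).1 h')
    cases v <;> first | (cases hv; done) | skip
    · exact absurd rfl hvl
    · exact iff_of_true ⟨.inl w2, wo⟩ h.write₁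
    · exact iff_of_true w1 h.write₂
    · exact iff_of_false (fun hn => c1 hn.1.1) h.writeOff
    · exact iff_of_false (fun hn => hn.1 f2) h.wipe
    · exact iff_of_false (fun hn => hn.2 f2) h.copy
    · rename_i v
      rw [h.buf₁]
      refine ⟨fun hn => ?_, fun hv => ⟨.inl ((b2 v).2 hv), wi⟩⟩
      rcases hn.1 with h1 | ⟨w, hw, hw'⟩
      · exact (b2 v).1 h1
      · exact h.feed v w hw (ht.fallHigh (eraseTrend_data (isData_of_mem_feed hw)) hw')
    · rename_i v
      rw [h.buf₂]
      exact ⟨fun hn => (b1 v).1 hn.1, fun hv => ⟨(b1 v).2 hv, wi⟩⟩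
    · rename_i f
      obtain ⟨v, hv, hσv⟩ := hσ f
      exact iff_of_true ⟨v, hv, (b2 v).2 hσv⟩ (h.full f)
    · rename_i v
      refine iff_of_false (fun hn => ?_) (h.put v)
      cases v <;> exact c1 hn.1
    · exact iff_of_false (fun hn => pv _ hn.1) (h.done _)
    · exact iff_of_false (fun ⟨v, _, hv⟩ => dv v hv) (h.stored _)

/-- The mode "erase" ends in the mode "copy", without a tick of the clock. -/
theorem EraseStart.run [Finite (Gate Q Γ m k)] (h : EraseStart M β σ y s)
    (hσ : ∀ f, ∃ v, v.field = f ∧ σ v) {t : ℕ → Gate Q Γ m k → Prop}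
    (hr : AsyncRun (next enc M x) t) {n₀ : ℕ} (hs : t n₀ = s) :
    ∃ n, n₀ < n ∧ StaysLow t clock n₀ n ∧ CopyStart σ (t n) := by
  obtain ⟨n, hn, hinv, hmono, hend⟩ := (h.phase hσ).run hr hs
  have ht := hinv n hn le_rfl
  have f2 : t n .fetch₂ := (ht.hold rfl).2 h.fetch₂
  have w2 : t n .write₂ := (ht.hold rfl).2 h.write₂
  have wi : ¬ t n .wipe := fun h' => h.wipe ((ht.hold rfl).1 h')
  have b2 : ∀ v, t n (.buf₂ v) ↔ σ v := fun v => (ht.hold rfl).trans (h.buf₂ v)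
  rcases hend with hq | hf
  · -- A quiet state of this phase would have `fetchOff` on, and thus `fetch₁` excited.
    exfalso
    have q1 : ∀ w : Gate Q Γ m k, w.IsData → ¬ t n w := fun w hw h' =>
      not_next_of_write₂ w2 hw ((hq w).2 h')
    have q2 : ¬ t n .fetchOn := fun h' => wi ((hq .fetchOn).2 h').1.1
    have q3 : t n .erase := (hq .erase).1 ⟨⟨f2, w2⟩, q2, wi, q1⟩
    have q4 : t n .loaded₂ := (hq .loaded₂).1 ((hq .loaded₁).1 (.inr w2))
    have q5 : t n .fetchOff := (hq .fetchOff).1 ⟨⟨q3, q4⟩, fun b =>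
      ⟨fun h' => ((hq (.mem₁ b)).2 h').2 q3, fun h' => ((hq (.mem₂ b)).2 h').2 q3⟩⟩
    exact ((hq .fetch₁).2 ((hq .fetch₂).2 f2)).2 q5
  · have f1 : ¬ t n .fetch₁ := by
      have := hf.excited
      simp only [next] at this
      tauto
    have fo : t n .fetchOff := by
      by_contra hfo
      exact f1 (ht.fall (v := .fetch₁) rfl ⟨.inl f2, hfo⟩)
    obtain ⟨⟨he, hl⟩, hmem⟩ := ht.rise (v := .fetchOff) rfl fo
    obtain ⟨-, hfo, -, hdata⟩ := ht.rise (v := .erase) rfl he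
    have ho : ∀ v, v ≠ .fetch₂ → (t (n + 1) v ↔ t n v) := hf.other
    refine ⟨n + 1, by omega, fun j hj hj' => ?_, ?_⟩
    · rcases (Nat.lt_succ_iff.1 hj').eq_or_lt with rfl | hj'
      · exact (ho _ (by simp)).1
      · exact (hmono j clock hj hj').2 (by simp [eraseTrend])
    · constructor
      case fetch₂ => exact fun h' => f1 (hf.new.1 h')
      case data =>
        intro v hv
        rw [ho v (by rintro rfl; exact hv)]; exact hdata v hv
      all_goals
        intros
        rw [ho _ (by simp)]
        first | assumption | skip
      · exact (ht.hold rfl).2 h.write₁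
      · exact ht.rise (v := .loaded₂) rfl hl
      · exact fun h' => h.writeOff ((ht.hold rfl).1 h')
      · exact fun h' => h.copy ((ht.hold rfl).1 h')
      · exact (ht.hold rfl).trans (h.buf₁ _)
      · exact b2 _
      · exact (ht.hold rfl).2 (h.full _)
      · exact fun h' => h.put _ ((ht.hold rfl).1 h')
      · exact fun h' => h.done _ ((ht.hold rfl).1 h')
      · exact fun h' => h.stored _ ((ht.hold rfl).1 h')
      · exact (hmem _).1
      · exact (hmem _).2
      · rename_i q hq
        exact ht.fall (v := .idle q) rfl fun hb => hq ((b2 _).1 hb)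

/-! ### The mode "copy" -/

/-- In the mode "copy", the stored bits rise, and then the acknowledgements `done` and `stored`, so
that `write₁` falls. -/
def copyTrend : Gate Q Γ m k → Trend
  | erase | fetchOff | writeOn | idle _ | write₁ => .fall
  | copy | put _ | done _ | stored _ | mem₁ _ | mem₂ _ | writeOff => .rise
  | _ => .hold

/-- The bits of the values `σ`. -/
def bitsOf (enc : Γ → Fin k → Bool) (σ : Value Q Γ m → Prop) (b : Bit Q m k) : Prop :=
  ∃ v, σ v ∧ b ∈ v.ones enc

/-- The state that the mode "copy" cannot exceed. -/
def copyGoal (enc : Γ → Fin k → Bool) (σ : Value Q Γ m → Prop) : Gate Q Γ m k → Prop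
  | put v | done v => σ v
  | mem₁ b | mem₂ b => bitsOf enc σ b
  | copy | stored _ | writeOff => True
  | idle q => ¬ σ (.st q)
  | _ => False

theorem copyTrend_data {v : Gate Q Γ m k} (hv : v.IsData) : copyTrend v = .hold := by
  cases v <;> first | rfl | exact hv.elim

/-- The mode "copy" is a phase, which ends when `write₂` is reset. -/
theorem CopyStart.phase (h : CopyStart σ s) (hσ : ∀ f, ∃ v, v.field = f ∧ σ v) :
    Phase (next enc M x) copyTrend .write₂ s (copyGoal enc σ) := by
  refine Phase.of_inputs rfl ?_ ?_ ?_ ?_ ?_ ?_ ?_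
  · intro v hv hs
    exfalso
    cases v <;> try (cases hv; done)
    · exact h.writeOff hs
    · exact h.copy hs
    · exact h.put _ hs
    · exact h.done _ hs
    · exact h.stored _ hs
    · exact h.mem₁ _ hs
    · exact h.mem₂ _ hs
  · intro v hv
    cases v <;> try (cases hv; done)
    · exact ⟨fun _ => h.write₁, fun _ => h.write₁⟩
    · exact ⟨fun _ => h.fetchOff, fun _ => h.fetchOff⟩
    · exact ⟨fun hn => absurd hn.1 h.fetch₂, False.elim⟩
    · exact ⟨fun _ => h.erase, fun _ => h.erase⟩
    · exact ⟨fun hn => h.idle _ fun hq => hn ((h.buf₂ _).2 hq), fun hq => h.idle _ hq⟩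
  · intro t v ht hv hn
    cases v <;> try (cases hv; done)
    · trivial
    · trivial
    · rename_i v
      have h2 : ∀ v, t (.buf₂ v) → σ v := fun v hv => (h.buf₂ v).1 ((ht.hold rfl).1 hv)
      cases v with
      | sym i a => exact h2 _ hn.2
      | pos i => exact h2 _ hn.2
      | st q =>
        by_contra hq
        exact hn.2 (ht.fallLow (v := .idle q) rfl hq)
    · exact ht.riseHigh (v := .put _) rfl hn.1
    · trivial
    · rcases hn.1 with h1 | ⟨v, hb, hv⟩
      · exact ht.riseHigh (v := .mem₂ _) rfl h1
      · exact ⟨v, ht.riseHigh (v := .put v) rfl hv, hb⟩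
    · exact ht.riseHigh (v := .mem₁ _) rfl hn.1
  · intro t v ht hv hd
    cases v <;> first | (cases hv; done) | exact hd.elim | skip
    exact fun hb => hd ((h.buf₂ _).1 ((ht.hold rfl).1 hb))
  · intro v hv
    cases v <;> try (cases hv; done)
    case put v => cases v <;> simp [posIn, negIn, copyTrend]
    all_goals
      simp [posIn, negIn, copyTrend]
      try (rintro _ _ _ rfl; simp)
  · intro v hv
    cases v <;> try (cases hv; done)
    case writeOn =>
      left
      intro t ht hn
      exact h.fetch₂ ((ht.hold rfl).1 hn.1)
    case erase =>
      left
      intro t ht hn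
      exact h.fetch₂ ((ht.hold rfl).1 hn.1.1)
    case fetchOff =>
      right
      refine ⟨by simp [posIn, copyTrend], ?_⟩
      rintro w (⟨b, rfl⟩ | ⟨b, rfl⟩) <;> simp [copyTrend]
    all_goals
      right
      simp [posIn, negIn, copyTrend]
  · intro t v ht hv hvl
    have w2 : t .write₂ := (ht.hold rfl).2 h.write₂
    by_cases hvd : v.IsData
    · exact iff_of_false (not_next_of_write₂ w2 hvd) (h.data v hvd)
    have f1 : ¬ t .fetch₁ := fun h' => h.fetch₁ ((ht.hold rfl).1 h')
    have f2 : ¬ t .fetch₂ := fun h' => h.fetch₂ ((ht.hold rfl).1 h')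
    have fo : ¬ t .fetchOn := fun h' => h.fetchOn ((ht.hold rfl).1 h')
    have wi : ¬ t .wipe := fun h' => h.wipe ((ht.hold rfl).1 h')
    have b1 : ∀ v, t (.buf₁ v) ↔ σ v := fun v => (ht.hold rfl).trans (h.buf₁ v)
    have b2 : ∀ v, t (.buf₂ v) ↔ σ v := fun v => (ht.hold rfl).trans (h.buf₂ v)
    cases v <;> first | (cases hv; done) | exact absurd trivial hvd | skip
    · exact iff_of_false (fun hn => hn.1.elim f2 fo) h.fetch₁
    · exact iff_of_false f1 h.fetch₂
    · exact absurd rfl hvl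
    · exact iff_of_true (.inr w2) h.loaded₁
    · exact iff_of_true ((ht.hold (v := .loaded₁) rfl).2 h.loaded₁) h.loaded₂
    · exact iff_of_false (fun hn => wi hn.1.1) h.fetchOn
    · exact iff_of_false (fun hn => hn.2 w2) h.wipe
    · rename_i v
      rw [h.buf₁]
      refine ⟨fun hn => ?_, fun hv => ⟨.inl ((b2 v).2 hv), wi⟩⟩
      rcases hn.1 with h1 | ⟨w, hw, hw'⟩
      · exact (b2 v).1 h1
      · have hwd := isData_of_mem_feed hw
        exact absurd ((ht.hold (copyTrend_data hwd)).1 hw') (h.data w hwd)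
    · rename_i v
      rw [h.buf₂]
      exact ⟨fun hn => (b1 v).1 hn.1, fun hv => ⟨(b1 v).2 hv, wi⟩⟩
    · rename_i f
      obtain ⟨v, hv, hσv⟩ := hσ f
      exact iff_of_true ⟨v, hv, (b2 v).2 hσv⟩ (h.full f)

/-- The mode "copy" ends in the mode "wipe" with the values of the buffer as stored bits, without a
tick of the clock. -/
theorem CopyStart.run [Finite (Gate Q Γ m k)] (h : CopyStart σ s)
    (hσ : ∀ f, ∃ v, v.field = f ∧ σ v) (huniq : ∀ v w, σ v → σ w → v.field = w.field → v = w)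
    {t : ℕ → Gate Q Γ m k → Prop} (hr : AsyncRun (next enc M x) t) {n₀ : ℕ} (hs : t n₀ = s) :
    ∃ n, n₀ < n ∧ StaysLow t clock n₀ n ∧ WipeStart enc M x (bitsOf enc σ) True (t n) := by
  obtain ⟨n, hn, hinv, hmono, hend⟩ := (h.phase hσ).run hr hs
  have ht := hinv n hn le_rfl
  have f2 : ¬ t n .fetch₂ := fun h' => h.fetch₂ ((ht.hold rfl).1 h')
  have w2 : t n .write₂ := (ht.hold rfl).2 h.write₂
  have wi : ¬ t n .wipe := fun h' => h.wipe ((ht.hold rfl).1 h')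
  have b2 : ∀ v, t n (.buf₂ v) ↔ σ v := fun v => (ht.hold rfl).trans (h.buf₂ v)
  have hdata : ∀ w, w.IsData → ¬ t n w := fun w hw h' =>
      h.data w hw ((ht.hold (copyTrend_data hw)).1 h')
  rcases hend with hq | hf
  · -- A quiet state of this phase would have `writeOff` on, and thus `write₁` excited.
    exfalso
    have q1 : ¬ t n .writeOn := fun h' => f2 ((hq .writeOn).2 h').1
    have q2 : ¬ t n .erase := fun h' => f2 ((hq .erase).2 h').1.1
    have q3 : ¬ t n .fetchOff := fun h' => q2 ((hq .fetchOff).2 h').1.1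
    have q4 : t n .copy := (hq .copy).1 ⟨w2, f2⟩
    have q5 : ∀ v, σ v → t n (.put v) := fun v hv => by
      refine (hq (.put v)).1 ?_
      cases v with
      | sym i a => exact ⟨q4, (b2 _).2 hv⟩
      | pos i => exact ⟨q4, (b2 _).2 hv⟩
      | st q => exact ⟨q4, fun h' => (hq (.idle q)).2 h' ((b2 _).2 hv)⟩
    have q6 : ∀ v, σ v → t n (.done v) := fun v hv => (hq (.done v)).1 ⟨q5 v hv, fun b hb =>
      (hq (.mem₂ b)).1 ⟨(hq (.mem₁ b)).1 ⟨.inr ⟨v, hb, q5 v hv⟩, q2⟩, q2⟩⟩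
    have q7 : t n .writeOff := (hq .writeOff).1 ⟨⟨q4, fun f => by
      obtain ⟨v, hv, hv'⟩ := hσ f
      exact (hq (.stored f)).1 ⟨v, hv, q6 v hv'⟩⟩, q1, q2, q3⟩
    exact ((hq .write₁).2 ((hq .write₂).2 w2)).2 q7
  · have w1 : ¬ t n .write₁ := by
      have := hf.excited
      simp only [next] at this
      tauto
    have wo : t n .writeOff := by
      by_contra hwo
      exact w1 (ht.fall (v := .write₁) rfl ⟨.inl w2, hwo⟩)
    obtain ⟨⟨hc, hst⟩, won, he, hfo⟩ := ht.rise (v := .writeOff) rfl wo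
    have hdone : ∀ v, σ v → t n (.done v) := fun v hv => by
      obtain ⟨w, hw, hw'⟩ := ht.rise (v := .stored _) rfl (hst v.field)
      rwa [huniq v w hv (ht.riseHigh (v := .done w) rfl hw') hw.symm]
    have hput : ∀ v, σ v ↔ t n (.put v) := fun v =>
      ⟨fun hv => (ht.rise (v := .done v) rfl (hdone v hv)).1, ht.riseHigh (v := .put v) rfl⟩
    have hm2 : ∀ b, t n (.mem₂ b) ↔ bitsOf enc σ b := fun b =>
      ⟨ht.riseHigh (v := .mem₂ b) rfl, fun ⟨v, hv, hb⟩ =>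
        (ht.rise (v := .done v) rfl (hdone v hv)).2 b hb⟩
    have hm1 : ∀ b, t n (.mem₁ b) ↔ bitsOf enc σ b := fun b =>
      ⟨ht.riseHigh (v := .mem₁ b) rfl, fun hb =>
        (ht.rise (v := .mem₂ b) rfl ((hm2 b).2 hb)).1⟩
    have hidle : ∀ q, ¬ σ (.st q) → t n (.idle q) := fun q hq => ht.fallLow (v := .idle q) rfl hq
    have ho : ∀ v, v ≠ .write₂ → (t (n + 1) v ↔ t n v) := hf.other
    refine ⟨n + 1, by omega, fun j hj hj' => ?_, ?_⟩
    · rcases (Nat.lt_succ_iff.1 hj').eq_or_lt with rfl | hj'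
      · exact (ho _ (by simp)).1
      · exact (hmono j clock hj hj').2 (by simp [copyTrend])
    · constructor
      case write₂ => exact fun h' => w1 (hf.new.1 h')
      case data =>
        intro v hv
        rw [ho v (by rintro rfl; exact hv)]; exact hdata v hv
      case stale =>
        intro v hv hn
        rw [ho v (by rintro rfl; exact hv)]
        cases v <;> first | exact hv.elim | skip
        · exact wo
        · exact hc
        · rename_i v
          refine (ht.hold rfl).2 ((h.buf₁ v).2 ?_)
          rcases hn.1 with h1 | ⟨w, hw, hw'⟩
          · exact (b2 v).1 ((ho _ (by simp)).1 h1)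
          · have hwd := isData_of_mem_feed hw
            exact absurd ((ho _ (by rintro rfl; exact hwd)).1 hw') (hdata w hwd)
        · rename_i v
          exact (b2 v).2 ((h.buf₁ v).1 ((ht.hold rfl).1 ((ho _ (by simp)).1 hn.1)))
        · exact (ht.hold rfl).2 (h.full _)
        · rename_i v
          rw [← hput]
          cases v with
          | sym i a => exact (b2 _).1 ((ho _ (by simp)).1 hn.2)
          | pos i => exact (b2 _).1 ((ho _ (by simp)).1 hn.2)
          | st q =>
            by_contra hq
            exact hn.2 ((ho _ (by simp)).2 (hidle q hq))
        · rename_i v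
          exact hdone v ((hput v).2 ((ho _ (by simp)).1 hn.1))
        · exact hst _
      case put =>
        intro v hv b hb
        exact ⟨v, (hput v).2 ((ho _ (by simp)).1 hv), hb⟩
      case idle =>
        intro q hq hb
        rw [ho _ (by simp)] at hq hb
        have := (ht.rise (v := .put (.st q)) rfl ((hput _).1 ((b2 _).1 hb))).2
        exact this hq
      all_goals
        intros
        rw [ho _ (by simp)]
        first | assumption | skip
      · exact fun h' => h.fetch₁ ((ht.hold rfl).1 h')
      · exact iff_of_true ((ht.hold rfl).2 h.loaded₁) trivial
      · exact iff_of_true ((ht.hold rfl).2 h.loaded₂) trivial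
      · exact fun h' => h.fetchOn ((ht.hold rfl).1 h')
      · exact hm1 _
      · exact hm2 _

end Modes

section Machine

variable {enc : Γ → Fin k → Bool} {M : Machine Q Γ} {x : Fin m → Γ}

/-! ### What the evaluation computes -/

/-- The values of the gates at the end of the evaluation of the first cycle. -/
def loadTarget (x : Fin m → Γ) : Gate Q Γ m k → Prop
  | boot | live => True
  | input i a => a ≠ x i
  | load i a => a = x i
  | _ => False

/-- The values of the gates at the end of the evaluation of a later cycle, in configuration `c`. -/
def stepTarget (M : Machine Q Γ) (c : Config Q Γ m) : Gate Q Γ m k → Prop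
  | clock | live => True
  | sense v => c.Has v
  | away i => c.head ≠ i
  | hit i a => c.tape i = a ∧ c.head = i
  | scan a => c.tape c.head = a
  | rule q a => c.state = q ∧ c.tape c.head = a
  | act a d => ∃ q, M.trans c.state (c.tape c.head) = some (q, a, d)
  | keep i a => c.tape i = a ∧ c.head ≠ i
  | move i a d => c.head = i ∧ ∃ q, M.trans c.state (c.tape c.head) = some (q, a, d)
  | _ => False

theorem evalTarget_load (β : Bit Q m k → Prop) :
    EvalTarget enc M x β False (loadTarget x) where
  top := by
    intro t hl _ ht v hv hn
    have hc : ¬ t clock := ht clock trivial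
    have hs : ∀ v, ¬ t (sense v) := fun v => ht (sense v) trivial
    have hh : ∀ i a, ¬ t (hit i a) := fun i a => ht (hit i a) trivial
    have hr : ∀ i a, ¬ t (rule i a) := fun i a => ht (rule i a) trivial
    cases v <;> first | exact hv.elim | skip
    case load i a =>
      by_contra hne
      exact ht (input i (x i)) trivial (hn.1.2 _ (Ne.symm hne)) rfl
    all_goals simp_all [next, loadTarget]
  quiet := by
    intro t hq hf hw hl _ v hv hD
    have hb : t boot := (hq boot).1 ⟨hf, fun h => hl.1 h, hw⟩
    cases v <;> first | exact hv.elim | exact hD.elim | skip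
    · exact hb
    · exact (hq live).1 ⟨.inl hb, hw⟩
    · exact (hq _).1 ⟨hD, hb, hw⟩
    · refine (hq _).1 ⟨⟨hb, fun b hb' => (hq _).1 ⟨?_, hb, hw⟩⟩, hw⟩
      obtain rfl := hD
      exact hb'

theorem evalTarget_step (henc : Function.Injective enc) (c : Config Q Γ m) :
    EvalTarget enc M x (c.HasBit enc) True (stepTarget M c) where
  top := by
    intro t hl hm ht v hv hn
    have hb : ¬ t boot := ht boot trivial
    have hs : ∀ v, t (sense v) → c.Has v := fun v => ht (sense v) trivial
    have hh : ∀ i a, t (hit i a) → c.tape i = a ∧ c.head = i := fun i a => ht (hit i a) trivial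
    have hsc : ∀ a, t (scan a) → c.tape c.head = a := fun a => ht (scan a) trivial
    have hr : ∀ q a, t (rule q a) → c.state = q ∧ c.tape c.head = a := fun q a =>
      ht (rule q a) trivial
    have ha : ∀ a d, t (act a d) → ∃ q, M.trans c.state (c.tape c.head) = some (q, a, d) :=
      fun a d => ht (act a d) trivial
    have haw : ∀ i, t (away i) → c.head ≠ i := fun i => ht (away i) trivial
    cases v <;> first | exact hv.elim | trivial | skip
    · exact hn.2.1 (hl.2 trivial)
    · exact hb hn.2.1
    · exact hb hn.1.1
    · rw [stepTarget, c.has_iff henc]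
      exact ⟨fun b h => (hm b).1 (hn.1.2 b h), fun b h h' => hn.2.2 b h ((hm b).2 h')⟩
    · obtain ⟨⟨i', hi, h⟩, -⟩ := hn
      have : c.head = i' := hs _ h
      rw [stepTarget, this]; exact hi
    · exact ⟨hs _ hn.1.1, hs _ hn.1.2⟩
    · obtain ⟨⟨i, h⟩, -⟩ := hn
      obtain ⟨h1, h2⟩ := hh _ _ h
      rwa [stepTarget, h2]
    · exact ⟨hs _ hn.1.1, hsc _ hn.1.2⟩
    · obtain ⟨⟨q, b, q', h, h'⟩, -⟩ := hn
      obtain ⟨rfl, rfl⟩ := hr _ _ h'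
      exact ⟨q', h⟩
    · exact ⟨hs _ hn.1.1, haw _ hn.1.2⟩
    · exact ⟨hs _ hn.1.1, ha _ _ hn.1.2⟩
  quiet := by
    intro t hq hf hw hl hm v hv hD
    have hc : t clock := (hq clock).1 ⟨⟨hf, hl.2 trivial⟩, hw⟩
    have hs : ∀ v, c.Has v → t (sense v) := fun v h => by
      rw [c.has_iff henc] at h
      exact (hq _).1 ⟨⟨hc, fun b hb => (hm b).2 (h.1 b hb)⟩, hw,
        fun b hb hb' => h.2 b hb ((hm b).1 hb')⟩
    have hh : ∀ i a, c.tape i = a → c.head = i → t (hit i a) := fun i a h1 h2 =>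
      (hq _).1 ⟨⟨hs (.sym i a) h1, hs (.pos i) h2⟩, hw⟩
    have hsc : t (scan (c.tape c.head)) := (hq (scan _)).1 ⟨⟨c.head, hh _ _ rfl rfl⟩, hw⟩
    have hr : t (rule c.state (c.tape c.head)) :=
      (hq (rule _ _)).1 ⟨⟨hs (.st c.state) rfl, hsc⟩, hw⟩
    have ha : ∀ a d, (∃ q, M.trans c.state (c.tape c.head) = some (q, a, d)) → t (act a d) :=
      fun a d ⟨q, h⟩ => (hq (act a d)).1 ⟨⟨_, _, q, h, hr⟩, hw⟩
    have haw : ∀ i, c.head ≠ i → t (away i) := fun i h =>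
      (hq (away i)).1 ⟨⟨c.head, h, hs (.pos c.head) rfl⟩, hw⟩
    cases v <;> first | exact hv.elim | exact hD.elim | skip
    · exact hc
    · exact (hq live).1 ⟨.inr hc, hw⟩
    · exact hs _ hD
    · exact haw _ hD
    · exact hh _ _ hD.1 hD.2
    · obtain rfl := hD; exact hsc
    · obtain ⟨rfl, rfl⟩ := hD; exact hr
    · exact ha _ _ hD
    · rename_i i a
      exact (hq (keep i a)).1 ⟨⟨hs (.sym i a) hD.1, haw i hD.2⟩, hw⟩
    · rename_i i a d
      exact (hq (move i a d)).1 ⟨⟨hs (.pos i) hD.1, ha _ _ hD.2⟩, hw⟩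

theorem fed_load (hm : 0 < m) :
    fed M (loadTarget x : Gate Q Γ m k → Prop) = (M.init hm x).Has := by
  funext v
  refine propext ⟨?_, fun h => ?_⟩
  · rintro ⟨w, hw, hD⟩
    cases v <;> simp only [feed, Set.mem_ofPred_eq] at hw
    · rcases hw with rfl | rfl | ⟨d, rfl⟩
      · exact hD.symm
      · exact hD.elim
      · exact hD.elim
    · rcases hw with ⟨rfl, h⟩ | ⟨i, a, d, -, rfl⟩
      · exact Fin.ext h.symm
      · exact hD.elim
    · rcases hw with ⟨rfl, h⟩ | ⟨q, a, b, d, -, rfl⟩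
      · exact h.symm
      · exact hD.elim
  · cases v with
    | sym i a => exact ⟨load i a, .inl rfl, h.symm⟩
    | pos i => exact ⟨boot, .inl ⟨rfl, congrArg Fin.val h.symm⟩, trivial⟩
    | st q => exact ⟨boot, .inl ⟨rfl, h.symm⟩, trivial⟩

/-- When the machine makes a step, the evaluation yields the next configuration. -/
theorem fed_step {c c' : Config Q Γ m} (hc : M.step c = some c') :
    fed M (stepTarget M c : Gate Q Γ m k → Prop) = c'.Has := by
  obtain ⟨⟨q, a, d⟩, htr, rfl⟩ := Option.map_eq_some_iff.1 hc
  funext v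
  refine propext ⟨?_, fun h => ?_⟩
  · rintro ⟨w, hw, hD⟩
    cases v <;> simp only [feed, Set.mem_ofPred_eq] at hw
    · rcases hw with rfl | rfl | ⟨d', rfl⟩
      · exact hD.elim
      · exact (Function.update_of_ne (Ne.symm hD.2) _ _).trans hD.1
      · obtain ⟨rfl, q', h⟩ := hD
        rw [htr] at h
        simp_all [Config.Has]
    · rcases hw with ⟨rfl, h⟩ | ⟨i, a, d, h', rfl⟩
      · exact hD.elim
      · obtain ⟨rfl, q', h⟩ := hD
        rw [htr] at h
        simp_all [Config.Has]
    · rcases hw with ⟨rfl, h⟩ | ⟨q', a', b, d', h, rfl⟩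
      · exact hD.elim
      · obtain ⟨rfl, rfl⟩ := hD
        rw [htr] at h
        simp_all [Config.Has]
  · cases v with
    | sym i b =>
      by_cases hi : c.head = i
      · subst hi
        simp only [Config.Has, Function.update_self] at h
        subst h
        exact ⟨move c.head a d, .inr (.inr ⟨d, rfl⟩), rfl, q, htr⟩
      · exact ⟨keep i b, .inr (.inl rfl), (Function.update_of_ne (Ne.symm hi) _ _).symm.trans h, hi⟩
    | pos i => exact ⟨move c.head a d, .inr ⟨c.head, a, d, h, rfl⟩, rfl, q, htr⟩
    | st q' =>
      obtain rfl : q = q' := h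
      exact ⟨rule c.state (c.tape c.head), .inr ⟨_, _, a, d, htr, rfl⟩, rfl, rfl⟩

/-- When the machine halts, the evaluation does not yield a next state. -/
theorem not_fed_of_halt {c : Config Q Γ m} (hc : M.step c = none) (q : Q) :
    ¬ fed M (stepTarget M c : Gate Q Γ m k → Prop) (.st q) := by
  have htr : M.trans c.state (c.tape c.head) = none := by simpa [Machine.step] using hc
  rintro ⟨w, hw, hD⟩
  simp only [feed, Set.mem_ofPred_eq] at hw
  rcases hw with ⟨rfl, h⟩ | ⟨q', a', b, d', h, rfl⟩
  · exact hD
  · obtain ⟨rfl, rfl⟩ := hD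
    simp [htr] at h

/-! ### The simulation -/

/-- In round `n`, the clock rises. -/
def Tick (t : ℕ → Gate Q Γ m k → Prop) (n : ℕ) : Prop :=
  ¬ t n clock ∧ t (n + 1) clock

/-- The latches of the stored bits hold the bits of `c`. -/
def Holds (enc : Γ → Fin k → Bool) (t : Gate Q Γ m k → Prop) (c : Config Q Γ m) : Prop :=
  ∀ b, (t (mem₁ b) ↔ c.HasBit enc b) ∧ (t (mem₂ b) ↔ c.HasBit enc b)

/-- A predicate that does not hold at `a`, holds at `b`, and persists in between is switched on
exactly once. -/
theorem exists_switch {P : ℕ → Prop} {a b : ℕ} (hab : a ≤ b) (ha : ¬ P a) (hb : P b)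
    (hmono : ∀ j, a ≤ j → j < b → P j → P (j + 1)) :
    ∃ j, a ≤ j ∧ j < b ∧ ∀ i, a ≤ i → i < b → ((¬ P i ∧ P (i + 1)) ↔ i = j) := by
  induction b, hab using Nat.le_induction with
  | base => exact absurd hb ha
  | succ b hab ih =>
    by_cases hPb : P b
    · obtain ⟨j, h1, h2, h3⟩ := ih hPb fun j hj hj' => hmono j hj (by omega)
      refine ⟨j, h1, by omega, fun i hi hi' => ?_⟩
      rcases (Nat.lt_succ_iff.1 hi').eq_or_lt with rfl | hlt
      · exact iff_of_false (fun h => h.1 hPb) (by omega)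
      · exact h3 i hi hlt
    · refine ⟨b, hab, by omega, fun i hi hi' => ⟨fun h => ?_, ?_⟩⟩
      · by_contra hne
        have hlt : i + 1 ≤ b := by omega
        refine hPb ?_
        have : ∀ l, i + 1 ≤ l → l ≤ b → P l := fun l hl => by
          induction l, hl using Nat.le_induction with
          | base => exact fun _ => h.2
          | succ l hl ih' => exact fun hle => hmono l (by omega) (by omega) (ih' (by omega))
        exact this b hlt le_rfl
      · rintro rfl
        exact ⟨hPb, hb⟩

variable {t : ℕ → Gate Q Γ m k → Prop} {n₀ : ℕ} {c c' : Config Q Γ m}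

theorem Config.fed_unique {D : Gate Q Γ m k → Prop} (h : fed M D = c.Has) :
    (∀ f, ∃ v, v.field = f ∧ fed M D v) ∧
      ∀ v w, fed M D v → fed M D w → v.field = w.field → v = w := by
  rw [h]
  exact ⟨c.exists_has, fun v w hv hw => Config.Has.eq hv hw⟩

variable [Finite (Gate Q Γ m k)]

/-- From the start of "erase" with a configuration in the buffer, the circuit arrives at the next
start of "evaluate" with this configuration in the stored bits, without a tick of the clock. -/
theorem EraseStart.cycle {β : Bit Q m k → Prop} {y : Prop} (hr : AsyncRun (next enc M x) t)
    (h : EraseStart M β c.Has y (t n₀)) :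
    ∃ n, n₀ ≤ n ∧ StaysLow t clock n₀ n ∧ EvalStart (c.HasBit enc) True (t n) := by
  have hbits : bitsOf enc c.Has = c.HasBit enc :=
    funext fun b => propext (c.hasBit_iff enc b).symm
  obtain ⟨n₁, h₁, l₁, hcopy⟩ := h.run c.exists_has hr rfl
  obtain ⟨n₂, h₂, l₂, hwipe⟩ := hcopy.run c.exists_has (fun v w hv hw => Config.Has.eq hv hw)
    hr rfl
  obtain ⟨n₃, h₃, l₃, heval⟩ := hwipe.run hr rfl
  rw [hbits] at heval
  refine ⟨n₃, by omega, fun j hj hj' => ?_, heval⟩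
  by_cases hj₁ : j < n₁
  · exact l₁ j hj hj₁
  by_cases hj₂ : j < n₂
  · exact l₂ j (by omega) hj₂
  · exact l₃ j (by omega) hj'

/-- A cycle of the circuit simulates a step of the machine, with a single tick of the clock. -/
theorem EvalStart.cycle (henc : Function.Injective enc) (hr : AsyncRun (next enc M x) t)
    (h : EvalStart (c.HasBit enc) True (t n₀)) (hc : M.step c = some c') :
    ∃ n j, n₀ ≤ j ∧ j < n ∧ (∀ i, n₀ ≤ i → i < n → (Tick t i ↔ i = j)) ∧
      Holds enc (t (j + 1)) c ∧ EvalStart (c'.HasBit enc) True (t n) := by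
  obtain ⟨hfull, huniq⟩ := Config.fed_unique (fed_step (k := k) hc)
  obtain ⟨n, hn, hmem, hmono, -, ⟨-, hnot, -⟩ | ⟨-, hclock, hlast, herase⟩⟩ :=
    h.run (evalTarget_step henc c) trivial hr rfl
  · exact absurd hfull hnot
  obtain ⟨j, hj, hj', huniq'⟩ :=
    exists_switch (P := fun n => t n clock) hn (h.data clock trivial) (hclock id) hmono
  have herase := herase huniq
  rw [fed_step hc] at herase
  obtain ⟨n', hn', hlow, heval⟩ := herase.cycle hr
  refine ⟨n', j, hj, by omega, fun i hi hi' => ?_, hmem _ (by omega) (by omega), heval⟩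
  by_cases hin : i < n
  · exact huniq' i hi hin
  · refine iff_of_false (fun ht => ht.1 ?_) (by omega)
    by_cases hin' : i = n
    · subst hin'; exact hlast.1 ht.2
    · exact hlow i (by omega) hi' ht.2

/-- When the machine halts, the circuit becomes quiet after a last tick of the clock. -/
theorem EvalStart.halt (henc : Function.Injective enc) (hr : AsyncRun (next enc M x) t)
    (h : EvalStart (c.HasBit enc) True (t n₀)) (hc : M.step c = none) :
    ∃ n j, n₀ ≤ j ∧ j < n ∧ (∀ i, n₀ ≤ i → i < n → (Tick t i ↔ i = j)) ∧
      Holds enc (t (j + 1)) c ∧ Quiet (next enc M x) (t n) ∧ Holds enc (t n) c := by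
  obtain ⟨n, hn, hmem, hmono, -, ⟨hq, -, hclock⟩ | ⟨hfull, -⟩⟩ :=
    h.run (evalTarget_step henc c) trivial hr rfl
  · obtain ⟨j, hj, hj', huniq'⟩ :=
      exists_switch (P := fun n => t n clock) hn (h.data clock trivial) (hclock trivial) hmono
    exact ⟨n, j, hj, hj', huniq', hmem _ (by omega) (by omega), hq, hmem _ hn le_rfl⟩
  · obtain ⟨v, hv, hfed⟩ := hfull .state
    cases v with
    | sym i a => cases hv
    | pos i => cases hv
    | st q => exact absurd hfed (not_fed_of_halt hc q)

/-- The first cycle loads the input, without a tick of the clock. -/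
theorem exists_evalStart_init (hm : 0 < m) (hr : AsyncRun (next enc M x) t) (h0 : ∀ v, ¬ t 0 v) :
    ∃ n, (∀ i, i < n → ¬ Tick t i) ∧
      EvalStart ((M.init hm x).HasBit enc) True (t n) := by
  have hw : WipeStart enc M x (fun _ => False) False (t 0) := by
    constructor
    case idle => exact fun q h => absurd h (h0 _)
    case put => exact fun v h => absurd h (h0 _)
    case data => exact fun v _ => h0 v
    case stale =>
      intro v hv hn
      cases v <;> first | exact hv.elim | skip
      case put v => cases v <;> exact absurd hn.1 (h0 _)
      all_goals simp [next, h0] at hn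
    all_goals intros; first | exact h0 _ | exact iff_of_false (h0 _) id
  obtain ⟨n₁, h₁, l₁, heval⟩ := hw.run hr rfl
  obtain ⟨hfull, huniq⟩ := Config.fed_unique (fed_load (k := k) (M := M) (x := x) hm)
  obtain ⟨n, hn, -, -, hclock, ⟨-, hnot, -⟩ | ⟨-, -, hlast, herase⟩⟩ :=
    heval.run (evalTarget_load _) trivial hr rfl
  · exact absurd hfull hnot
  have herase := herase huniq
  rw [fed_load hm] at herase
  obtain ⟨n₂, h₂, l₂, hend⟩ := herase.cycle hr
  refine ⟨n₂, fun i hi ht => ?_, hend⟩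
  by_cases hi₁ : i < n₁
  · exact ht.1 (l₁ i (by omega) hi₁ ht.2)
  by_cases hi₂ : i < n
  · exact hclock (i + 1) (by omega) (by omega) ht.2
  by_cases hi₃ : i = n
  · subst hi₃; exact ht.1 (hlast.1 ht.2)
  · exact ht.1 (l₂ i (by omega) hi ht.2)

end Machine

section Simulation

variable {enc : Γ → Fin k → Bool} {M : Machine Q Γ} {x : Fin m → Γ}
variable {t : ℕ → Gate Q Γ m k → Prop} {n₀ : ℕ} {c c' : Config Q Γ m}

open Classical in
/-- The number of ticks of the clock before round `n`. -/
noncomputable def ticks (t : ℕ → Gate Q Γ m k → Prop) (n : ℕ) : ℕ :=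
  ((Finset.range n).filter (Tick t)).card

theorem ticks_succ (n : ℕ) [Decidable (Tick t n)] :
    ticks t (n + 1) = ticks t n + if Tick t n then 1 else 0 := by
  classical
  unfold ticks
  rw [Finset.range_add_one, Finset.filter_insert]
  split_ifs with h
  · rw [Finset.card_insert_of_notMem (by simp)]
  · rfl

theorem ticks_eq_of_not_tick {a b : ℕ} (hab : a ≤ b) (h : ∀ i, a ≤ i → i < b → ¬ Tick t i) :
    ticks t b = ticks t a := by
  classical
  induction b, hab using Nat.le_induction with
  | base => rfl
  | succ b hab ih =>
    rw [ticks_succ, if_neg (h b hab (by omega)), add_zero,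
      ih fun i hi hi' => h i hi (by omega)]

theorem ticks_of_unique {a b j : ℕ} (ha : a ≤ j) (hb : j < b)
    (h : ∀ i, a ≤ i → i < b → (Tick t i ↔ i = j)) :
    ticks t j = ticks t a ∧ ticks t b = ticks t a + 1 := by
  classical
  have h1 : ticks t j = ticks t a := ticks_eq_of_not_tick ha fun i hi hi' => by
    rw [h i hi (by omega)]; omega
  refine ⟨h1, ?_⟩
  rw [ticks_eq_of_not_tick (a := j + 1) hb fun i hi hi' => by rw [h i (by omega) hi']; omega,
    ticks_succ, if_pos ((h j ha hb).2 rfl), h1]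

/-- In round `i`, the ticks of the clock number the configurations correctly. -/
def TickSound (enc : Γ → Fin k → Bool) (M : Machine Q Γ) (hm : 0 < m) (x : Fin m → Γ)
    (t : ℕ → Gate Q Γ m k → Prop) (i : ℕ) : Prop :=
  Tick t i → ∃ c, M.configAt hm x (ticks t i) = some c ∧ Holds enc (t (i + 1)) c

variable [Finite (Gate Q Γ m k)] (henc : Function.Injective enc) (hm : 0 < m)
  (hr : AsyncRun (next enc M x) t) (h0 : ∀ v, ¬ t 0 v)

include henc hm hr h0

/-- Each configuration of the machine has its cycle, and the ticks before are sound. -/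
theorem exists_evalStart (T : ℕ) (hc : M.configAt hm x T = some c) :
    ∃ n, T ≤ n ∧ EvalStart (c.HasBit enc) True (t n) ∧ ticks t n = T ∧
      ∀ i, i < n → TickSound enc M hm x t i := by
  induction T generalizing c with
  | zero =>
    obtain ⟨n, hno, hstart⟩ := exists_evalStart_init (M := M) hm hr h0
    obtain rfl : M.init hm x = c := by simpa [Machine.configAt] using hc
    exact ⟨n, Nat.zero_le n, hstart, by
      rw [ticks_eq_of_not_tick (Nat.zero_le n) fun i _ => hno i]; simp [ticks],
      fun i hi ht => absurd ht (hno i hi)⟩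
  | succ T ih =>
    obtain ⟨c₀, hc₀, hstep⟩ := Option.bind_eq_some_iff.1 hc
    obtain ⟨n₀, hn₀, hstart, hticks, hsound⟩ := ih hc₀
    obtain ⟨n, j, hj, hj', huniq, hholds, hnext⟩ := hstart.cycle henc hr hstep
    obtain ⟨h1, h2⟩ := ticks_of_unique hj hj' huniq
    refine ⟨n, by omega, hnext, by omega, fun i hi ht => ?_⟩
    by_cases hi₀ : i < n₀
    · exact hsound i hi₀ ht
    · obtain rfl := (huniq i (by omega) hi).1 ht
      exact ⟨c₀, by rw [h1, hticks, hc₀], hholds⟩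

/-- If the machine halts after `T` steps, the circuit becomes quiet after its tick number `T`
(counted from `0`). -/
theorem exists_quiet (T : ℕ) (hc : M.configAt hm x T = some c) (hhalt : M.step c = none) :
    ∃ n j, (∀ i, TickSound enc M hm x t i) ∧ Tick t j ∧ ticks t j = T ∧
      Quiet (next enc M x) (t n) ∧ Holds enc (t n) c := by
  obtain ⟨n₀, hn₀, hstart, hticks, hsound⟩ := exists_evalStart henc hm hr h0 T hc
  obtain ⟨n, j, hj, hj', huniq, hholds, hq, hend⟩ := hstart.halt henc hr hhalt
  obtain ⟨h1, h2⟩ := ticks_of_unique hj hj' huniq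
  refine ⟨n, j, fun i ht => ?_, (huniq j hj hj').2 rfl, h1.trans hticks, hq, hend⟩
  by_cases hi₀ : i < n₀
  · exact hsound i hi₀ ht
  by_cases hi : i < n
  · obtain rfl := (huniq i (by omega) hi).1 ht
    exact ⟨c, by rw [h1, hticks, hc], hholds⟩
  · refine absurd ht.2 ?_
    rw [hr.eq_of_quiet (by omega : n ≤ i + 1) hq, ← hr.eq_of_quiet (by omega : n ≤ i) hq]
    exact ht.1

theorem exists_tick (T : ℕ) (hc : M.configAt hm x T = some c) : ∃ j, Tick t j ∧ ticks t j = T := by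
  cases hstep : M.step c with
  | none =>
    obtain ⟨n, j, -, hj, hj', -⟩ := exists_quiet henc hm hr h0 T hc hstep
    exact ⟨j, hj, hj'⟩
  | some c' =>
    obtain ⟨n₀, hn₀, hstart, hticks, hsound⟩ := exists_evalStart henc hm hr h0 T hc
    obtain ⟨n, j, hj, hj', huniq, -⟩ := hstart.cycle henc hr hstep
    exact ⟨j, (huniq j hj hj').2 rfl, (ticks_of_unique hj hj' huniq).1.trans hticks⟩

omit [Finite (Gate Q Γ m k)] henc hr h0 in
/-- A machine halts, or has a configuration after every number of steps. -/
theorem exists_halt_or (M : Machine Q Γ) (x : Fin m → Γ) :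
    (∃ T c, M.configAt hm x T = some c ∧ M.step c = none) ∨
      ∀ T, ∃ c, M.configAt hm x T = some c := by
  by_cases h : ∃ T c, M.configAt hm x T = some c ∧ M.step c = none
  · exact .inl h
  · refine .inr fun T => ?_
    induction T with
    | zero => exact ⟨_, rfl⟩
    | succ T ih =>
      obtain ⟨c, hc⟩ := ih
      cases hs : M.step c with
      | none => exact absurd ⟨T, c, hc, hs⟩ h
      | some c' => exact ⟨c', by simp [Machine.configAt, hc, hs]⟩

/-- All ticks of the clock are sound: a round is covered by a later start of a cycle, or by the
quiet state after the machine has halted. -/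
theorem tickSound (i : ℕ) : TickSound enc M hm x t i := by
  rcases exists_halt_or hm M x with ⟨T, c, hc, hs⟩ | h
  · obtain ⟨n, j, hsound, -⟩ := exists_quiet henc hm hr h0 T hc hs
    exact hsound i
  · obtain ⟨c, hc⟩ := h (i + 1)
    obtain ⟨n, hn, -, -, hsound⟩ := exists_evalStart henc hm hr h0 (i + 1) hc
    exact hsound i (by omega)

theorem halts_of_quiet {n : ℕ} (hq : Quiet (next enc M x) (t n)) :
    ∃ T c, M.configAt hm x T = some c ∧ M.step c = none ∧ Holds enc (t n) c := by
  rcases exists_halt_or hm M x with ⟨T, c, hc, hs⟩ | h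
  · obtain ⟨n', j, -, -, -, hq', hholds⟩ := exists_quiet henc hm hr h0 T hc hs
    refine ⟨T, c, hc, hs, ?_⟩
    rcases le_total n n' with hle | hle
    · rwa [← hr.eq_of_quiet hle hq]
    · rwa [hr.eq_of_quiet hle hq']
  · -- A start of "evaluate" is not quiet: the gate `wipe` is on, but `fetch₂` vetoes it.
    obtain ⟨c, hc⟩ := h n
    obtain ⟨n', hn', hstart, -⟩ := exists_evalStart henc hm hr h0 n hc
    rw [hr.eq_of_quiet hn' hq] at hstart
    exact absurd hstart.fetch₂ ((hq .wipe).2 hstart.wipe).1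

end Simulation

/-! ### The number of banks -/

section Cardinality

instance : Fintype Move := Fintype.ofEquiv _ (proxy_equiv% Move)

instance : Fintype (Field m) := Fintype.ofEquiv _ (proxy_equiv% (Field m))

variable [Fintype Q]

instance : Fintype (Bit Q m k) := Fintype.ofEquiv _ (proxy_equiv% (Bit Q m k))

theorem card_bit : Fintype.card (Bit Q m k) = m * k + Nat.clog 2 m + Fintype.card Q := by
  rw [Fintype.ofEquiv_card]
  simp only [Fintype.card_sum, Fintype.card_sigma, Finset.sum_const, Finset.card_univ,
    Fintype.card_fin, smul_eq_mul]
  ring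

theorem card_field : Fintype.card (Field m) = m + 2 := by
  rw [Fintype.ofEquiv_card]
  simp only [Fintype.card_sum, Fintype.card_fin, Fintype.card_unit]

variable [Fintype Γ]

instance : Fintype (Value Q Γ m) := Fintype.ofEquiv _ (proxy_equiv% (Value Q Γ m))

instance : Fintype (Gate Q Γ m k) := Fintype.ofEquiv _ (proxy_equiv% (Gate Q Γ m k))

theorem card_value : Fintype.card (Value Q Γ m) = m * Fintype.card Γ + m + Fintype.card Q := by
  rw [Fintype.ofEquiv_card]
  simp only [Fintype.card_sum, Fintype.card_sigma, Finset.sum_const, Finset.card_univ,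
    Fintype.card_fin, smul_eq_mul]
  ring

theorem card_move : Fintype.card Move = 3 := rfl

theorem card_gate_le (hm : 0 < m) (hΓ : Fintype.card Γ ≤ 2 ^ k) :
    Fintype.card (Gate Q Γ m k) + 2 ≤
      (64 * 2 ^ k + 2 * k) * (Fintype.card Q + Nat.clog 2 m + m) := by
  rw [Fintype.ofEquiv_card]
  simp only [Fintype.card_sum, Fintype.card_sigma, Finset.sum_const, Finset.card_univ, card_move,
    card_field, card_bit, card_value, Fintype.card_fin, smul_eq_mul, Fintype.card_unit]
  generalize Fintype.card Γ = g at *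
  generalize Fintype.card Q = q
  generalize Nat.clog 2 m = L
  have hG : 1 ≤ 2 ^ k := Nat.one_le_two_pow
  generalize 2 ^ k = G at *
  have h1 : m * g ≤ m * G := Nat.mul_le_mul_left m hΓ
  have h2 : q * g ≤ q * G := Nat.mul_le_mul_left q hΓ
  have h3 : m ≤ m * G := Nat.le_mul_of_pos_right m hG
  have h4 : q ≤ q * G := Nat.le_mul_of_pos_right q hG
  have h5 : L ≤ L * G := Nat.le_mul_of_pos_right L hG
  have h6 : G ≤ m * G := Nat.le_mul_of_pos_left G hm
  have e : (64 * G + 2 * k) * (q + L + m) = 64 * (q * G) + 64 * (L * G) + 64 * (m * G) +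
      2 * (k * q) + 2 * (k * L) + 2 * (m * k) := by ring
  have e' : m * (g * 3) = 3 * (m * g) := by ring
  rw [e, e']
  generalize m * g = a1 at *
  generalize q * g = a2 at *
  generalize m * G = a3 at *
  generalize q * G = a4 at *
  generalize L * G = a5 at *
  generalize m * k = a6 at *
  omega

end Cardinality

/-! ### The network of a machine -/

section Network

/-- The gates that play the distinguished roles. -/
def portGate : Port Q Γ m k → Gate Q Γ m k
  | .input i a => input i a
  | .cell₁ i j => mem₁ (.cell i j)
  | .cell₂ i j => mem₂ (.cell i j)
  | .addr₁ l => mem₁ (.addr l)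
  | .addr₂ l => mem₂ (.addr l)
  | .ctrlU q => idle q
  | .ctrlW q => put (.st q)
  | .ctrl₁ q => mem₁ (.ctrl q)
  | .ctrl₂ q => mem₂ (.ctrl q)
  | .clock => clock

theorem portGate_injective : Function.Injective (portGate : Port Q Γ m k → Gate Q Γ m k) := by
  intro p p' h
  cases p <;> cases p' <;> simp_all [portGate]

variable {ι : Type*} (e : Gate Q Γ m k ≃ ι)

/-- The distinguished banks. -/
def portBank (p : Port Q Γ m k) : Bank ι := Bank.gate (e (portGate p))

theorem portBank_injective : Function.Injective (portBank e) := fun _ _ h =>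
  portGate_injective (e.injective (Option.some.inj (Option.some.inj h)))

variable (enc : Γ → Fin k → Bool) (M : Machine Q Γ)

/-- The circuit of a machine, with its gates renamed. -/
abbrev renamedCircuit : Circuit ι := (machineCircuit enc M).map e

theorem isStableBit_mem [Fintype ι] (b : Bit Q m k) :
    IsStableBit (renamedCircuit e enc M).contracts (renamedCircuit e enc M).external
      (Bank.gate (e (mem₁ b))) (Bank.gate (e (mem₂ b))) := by
  apply Circuit.isStableBit <;>
    simp [Circuit.map, machineCircuit, AllOf, posIn, negIn]

theorem usesGadgets [Fintype ι] : UsesGadgets (renamedCircuit e enc M).contracts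
    (renamedCircuit e enc M).external (portBank e) where
  cell _ _ := isStableBit_mem e enc M _
  addr _ := isStableBit_mem e enc M _
  ctrl q := by
    refine Circuit.isStateGadget _ (Circuit.isConditionGadget _ (p := e (buf₂ (.st q)))
      (g := e copy) ?_ ?_ ?_ ?_ ?_ ?_ ?_ ?_) (isStableBit_mem e enc M _) ?_
    all_goals
      simp [Circuit.map, machineCircuit, AllOf, posIn, negIn, portGate, Value.ones,
        Equiv.symm_apply_eq]

variable {e enc M}

theorem withInput_eq [Fintype ι] (x : Fin m → Γ) :
    withInput (renamedCircuit e enc M).external (portBank e) x =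
      (renamedCircuit e enc M).externalBlocked {v | ∃ i, v = e (input i (x i))} := by
  funext b
  have : (∃ i, portBank e (.input i (x i)) = b) ↔
      ∃ v ∈ {v | ∃ i, v = e (input i (x i))}, b = Bank.gate v := by
    simp only [portBank, portGate, Set.mem_ofPred_eq]
    exact ⟨fun ⟨i, hi⟩ => ⟨_, ⟨i, rfl⟩, hi.symm⟩, fun ⟨_, ⟨i, rfl⟩, h⟩ => ⟨i, h.symm⟩⟩
  unfold withInput Circuit.externalBlocked
  by_cases h : ∃ i, portBank e (.input i (x i)) = b
  · rw [if_pos h, if_pos (this.1 h)]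
  · rw [if_neg h, if_neg (mt this.2 h)]

/-- An input gate has `boot` as its only positive input, so one unit of assets blocks it. -/
theorem blocked_valid (x : Fin m → Γ) : ∀ v ∈ {v | ∃ i, v = e (input i (x i))},
    ¬ (renamedCircuit e enc M).conj v ∧ ((renamedCircuit e enc M).pos v).ncard ≤ 1 := by
  rintro _ ⟨i, rfl⟩
  refine ⟨by simp [Circuit.map, machineCircuit, AllOf], ?_⟩
  simp [Circuit.map, machineCircuit, posIn, Equiv.symm_apply_eq]

theorem storesBit_rates {t : ι → Prop} {v₁ v₂ : Gate Q Γ m k} {p : Prop} (h₁ : ¬ v₁.AllOf)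
    (h₂ : ¬ v₂.AllOf) (ht₁ : t (e v₁) ↔ p) (ht₂ : t (e v₂) ↔ p) :
    StoresBit ((renamedCircuit e enc M).rates t) (Bank.gate (e v₁)) (Bank.gate (e v₂)) p := by
  have hs₁ : (renamedCircuit e enc M).scale (e v₁) = 1 := by
    simp [Circuit.scale, Circuit.map, machineCircuit, h₁]
  have hs₂ : (renamedCircuit e enc M).scale (e v₂) = 1 := by
    simp [Circuit.scale, Circuit.map, machineCircuit, h₂]
  constructor
  · intro hp
    simp [Circuit.rates, ht₁.2 hp, ht₂.2 hp, hs₁, hs₂]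
  · intro hp
    simp [Circuit.rates, mt ht₁.1 hp, mt ht₂.1 hp]

theorem represents_of_holds {t : ι → Prop} {c : Config Q Γ m} (h : Holds enc (t ∘ e) c) :
    Represents enc (portBank e) ((renamedCircuit e enc M).rates t) c where
  tape i j := storesBit_rates (by simp [AllOf, portGate]) (by simp [AllOf, portGate])
    (h (.cell i j)).1 (h (.cell i j)).2
  head l := storesBit_rates (by simp [AllOf, portGate]) (by simp [AllOf, portGate])
    (h (.addr l)).1 (h (.addr l)).2
  state q := storesBit_rates (by simp [AllOf, portGate]) (by simp [AllOf, portGate])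
    (h (.ctrl q)).1 (h (.ctrl q)).2

theorem eval_renamed (x : Fin m → Γ) (t : ι → Prop) (v : Gate Q Γ m k) :
    (renamedCircuit e enc M).eval {v | ∃ i, v = e (input i (x i))} t (e v) ↔
      next enc M x (t ∘ e) v := by
  rw [Circuit.eval_map, ← machineCircuit_eval]
  simp [Set.preimage]

theorem quiet_renamed (x : Fin m → Γ) (t : ι → Prop) :
    Quiet ((renamedCircuit e enc M).eval {v | ∃ i, v = e (input i (x i))}) t ↔
      Quiet (next enc M x) (t ∘ e) := by
  simp only [Quiet, e.surjective.forall, eval_renamed, Function.comp_apply]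

theorem asyncRun_renamed {x : Fin m → Γ} {t : ℕ → ι → Prop}
    (hr : AsyncRun ((renamedCircuit e enc M).eval {v | ∃ i, v = e (input i (x i))}) t) :
    AsyncRun (next enc M x) fun n => t n ∘ e := by
  intro n
  rcases hr n with ⟨v, hv⟩ | ⟨hq, h⟩
  · obtain ⟨v, rfl⟩ := e.surjective v
    refine .inl ⟨v, fun h => hv.excited ((eval_renamed x _ v).trans h),
      hv.new.trans (eval_renamed x _ v), fun u hu => hv.other _ (e.injective.ne hu)⟩
  · exact .inr ⟨(quiet_renamed x _).1 hq, by simp only [h]⟩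

theorem simulatesRun [Fintype ι] (henc : Function.Injective enc) (hm : 0 < m) (x : Fin m → Γ)
    {r : ℕ → Bank ι → ℝ}
    (hr : IsRun (renamedCircuit e enc M).contracts
      (withInput (renamedCircuit e enc M).external (portBank e) x) r) :
    SimulatesRun (renamedCircuit e enc M).contracts
      (withInput (renamedCircuit e enc M).external (portBank e) x) enc (portBank e) M hm x r := by
  have := Finite.of_equiv _ e.symm
  rw [withInput_eq] at hr ⊢
  obtain ⟨t, h0, ht, hrt⟩ := Circuit.exists_asyncRun (blocked_valid x) hr
  have ht' := asyncRun_renamed ht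
  have h0' : ∀ v, ¬ (t 0 ∘ e) v := fun v => h0 _
  have htick : ∀ n, DefaultingStep r (portBank e .clock) n ↔ Tick (fun n => t n ∘ e) n := by
    intro n
    rw [DefaultingStep, hrt, hrt, portBank, Circuit.rates_gate_eq_one, Circuit.rates_gate_lt_one]
    rfl
  have hcount : ∀ n, defaultCount r (portBank e .clock) n = ticks (fun n => t n ∘ e) n := by
    intro n
    unfold defaultCount ticks
    congr 1
    ext i
    simp only [Finset.mem_filter, htick]
  have hstab : ∀ n, Stabilized (renamedCircuit e enc M).contracts
      ((renamedCircuit e enc M).externalBlocked {v | ∃ i, v = e (input i (x i))}) (r n) ↔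
      Quiet (next enc M x) (t n ∘ e) := by
    intro n
    rw [hrt, Circuit.stabilized_iff (blocked_valid x), quiet_renamed]
  constructor
  · intro n hn
    obtain ⟨c, hc, hholds⟩ := tickSound henc hm ht' h0' n ((htick n).1 hn)
    exact ⟨c, by rw [hcount, hc], by rw [hrt]; exact represents_of_holds hholds⟩
  · rintro T ⟨c, hc⟩
    obtain ⟨j, hj, hj'⟩ := exists_tick henc hm ht' h0' T hc
    exact ⟨j, (htick j).2 hj, by rw [hcount, hj']⟩
  · rintro ⟨T, c, hc, hs⟩
    obtain ⟨n, -, -, -, -, hq, -⟩ := exists_quiet henc hm ht' h0' T hc hs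
    exact ⟨n, (hstab n).2 hq⟩
  · intro n hn
    obtain ⟨T, c, hc, hs, hholds⟩ := halts_of_quiet henc hm ht' h0' ((hstab n).1 hn)
    exact ⟨T, c, hc, hs, by rw [hrt]; exact represents_of_holds hholds⟩

end Network

end FinNet

theorem mainTheorem10 (k : ℕ) :
    ∃ C : ℕ, ∀ (Q : Type*) (Γ : Type*) [Fintype Q] (enc : Γ → Fin k → Bool)
      (_henc : Function.Injective enc) (M : FinNet.Machine Q Γ) (m : ℕ) (hm : 0 < m),
      ∃ (B : Type) (_ : Fintype B) (N : FinNet.Contracts B) (e : B → ℝ≥0)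
        (port : FinNet.Port Q Γ m k → B),
        Fintype.card B ≤ C * (Fintype.card Q + Nat.clog 2 m + m) ∧
        Function.Injective port ∧
        FinNet.UsesGadgets N e port ∧
        ∀ (x : Fin m → Γ) (r : ℕ → B → ℝ),
          FinNet.IsRun N (FinNet.withInput e port x) r →
            FinNet.SimulatesRun N (FinNet.withInput e port x) enc port M hm x r := by
  refine ⟨64 * 2 ^ k + 2 * k, fun Q Γ _ enc henc M m hm => ?_⟩
  have : Finite Γ := Finite.of_injective enc henc
  have := Fintype.ofFinite Γ
  have hΓ : Fintype.card Γ ≤ 2 ^ k := by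
    simpa using Fintype.card_le_of_injective enc henc
  -- The gates live in the universe of `Q` and `Γ`; numbering them gives banks in `Type`.
  let e := Fintype.equivFin (FinNet.Gate Q Γ m k)
  refine ⟨FinNet.Bank (Fin (Fintype.card (FinNet.Gate Q Γ m k))), inferInstance,
    (FinNet.renamedCircuit e enc M).contracts, (FinNet.renamedCircuit e enc M).external,
    FinNet.portBank e, ?_, FinNet.portBank_injective e, FinNet.usesGadgets e enc M,
    fun x r hr => FinNet.simulatesRun henc hm x hr⟩
  have h := FinNet.card_gate_le (Q := Q) hm hΓ
  rw [Fintype.card_option, Fintype.card_option, Fintype.card_fin]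
  exact h
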